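/- **Setting.** Let $\Omega$ be a Polish space with its Borel $\sigma$-algebra, let $\mu$ be a probability measure on $\Omega$, and let $(Z_t)_{t\ge 0}$ be a time-homogeneous Markov process on $\Omega$, given by its transition kernels (the laws of $Z_t$ given $Z_0=z$; they are the identity at $t=0$ and satisfy the Chapman–Kolmogorov equation). For real-valued or $d\times d$ complex matrix-valued $f$ put $(P_tf)(z)=\mathbb E[f(Z_t)\mid Z_0=z]$, where expectations of matrices are taken entrywise. Assume that * $\mu$ is stationary for $(P_t)$; * $(P_t)$ is reversible: $\mathbb E_\mu[(P_tf)g]=\mathbb E_\mu[f(P_tg)]$ for all $t\ge0$ and all real-valued $f,g\in L_2(\mu)$; * $(P_t)$ is ergodic: $P_tf\to\mathbb E_\mu f$ in $L_2(\mu)$ as $t\to\infty$ for all real-valued $f\in L_2(\mu)$. The generator is $(\mathcal Lf)(z)=\lim_{t\downarrow0}\big((P_tf)(z)-f(z)\big)/t$. Fix an algebra $\mathcal A$ of *suitable* functions, that is, an algebra of measurable functions $\Omega\to\mathbb R$ containing the constants such that for every $f\in\mathcal A$: $f\in L_2(\mu)$; $f(Z_t)$ is integrable given $Z_0=z$, for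 all $t\ge0$ and $z\in\Omega$; the limit defining $\mathcal Lf$ exists at every $z\in\Omega$ and also holds in $L_2(\mu)$; and $\mathcal Lf\in\mathcal A$ and $P_tf\in\mathcal A$ for all $t\ge0$. Let $\mathbb H_d$ be the space of $d\times d$ complex Hermitian matrices. A function $f:\Omega\to\mathbb H_d$ is called suitable if the real and imaginary parts of all its entries belong to $\mathcal A$. Define $$\Gamma(f,g)=\tfrac12\big[\mathcal L(fg)-f\,\mathcal L(g)-\mathcal L(f)\,g\big],\qquad \Gamma_2(f,g)=\tfrac12\big[\mathcal L\Gamma(f,g)-\Gamma(f,\mathcal Lg)-\Gamma(\mathcal Lf,g)\big],$$ and $\Gamma(f)=\Gamma(f,f)$, $\Gamma_2(f)=\Gamma_2(f,f)$. Write $A\preccurlyeq B$ when $B-A$ is positive semidefinite, $\|\cdot\|$ for the $\ell_2$ operator norm and $\operatorname{tr}$ for the trace; functions of Hermitian matrices are defined by the spectral calculus and bind before the trace. **Theorem (Polynomial moments).** Let $c>0$, and assume the Bakry–Émery criterion: for every suitable $f:\Omega\to\mathbb H_d$, the inequality $\Gamma(f)\preccurlyeq c\,\Gamma_2(f)$ holds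 $\mu$-almost everywhere. Let $f:\Omega\to\mathbb H_d$ be suitable, and let $q=1$ or $q\ge 1.5$. Then $\operatorname{tr}|f-\mathbb E_\mu f|^{2q}$ and $\operatorname{tr}\Gamma(f)^q$ are $\mu$-integrable, and $$\Big[\mathbb E_\mu\operatorname{tr}|f-\mathbb E_\mu f|^{2q}\Big]^{1/(2q)}\le\sqrt{c\,(2q-1)}\,\Big[\mathbb E_\mu\operatorname{tr}\Gamma(f)^q\Big]^{1/(2q)}.$$ If moreover $v_f:=\big\|\,\|\Gamma(f)\|\,\big\|_{L_\infty(\mu)}<+\infty$, then $$\Big[\mathbb E_\mu\operatorname{tr}|f-\mathbb E_\mu f|^{2q}\Big]^{1/(2q)}\le d^{1/(2q)}\sqrt{c\,(2q-1)\,v_f}.$$ -/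

import Mathlib

open MeasureTheory ProbabilityTheory Filter Topology
open scoped ComplexOrder

/-- The transition semigroup of a time-homogeneous Markov process `(Z_t)` with values in `Ω`:
`kernel t z` is the law of `Z_t` conditionally on `Z_0 = z`, and the last field is the
Chapman--Kolmogorov equation. -/
structure MarkovSemigroup (Ω : Type*) [MeasurableSpace Ω] where
  kernel : NNReal → Kernel Ω Ω
  isMarkov : ∀ t, IsMarkovKernel (kernel t)
  kernel_zero : kernel 0 = Kernel.id
  kernel_add : ∀ s t, kernel (s + t) = kernel t ∘ₖ kernel s

/-- The entrywise expectation of a matrix-valued function. -/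
noncomputable def matExpect {Ω : Type*} [MeasurableSpace Ω] {d : ℕ} (ν : Measure Ω)
    (f : Ω → Matrix (Fin d) (Fin d) ℂ) : Matrix (Fin d) (Fin d) ℂ :=
  Matrix.of fun i j => ∫ y, f y i j ∂ν

/-- The `ℓ₂` operator norm of a matrix. -/
noncomputable def specNorm {d : ℕ} (A : Matrix (Fin d) (Fin d) ℂ) : ℝ :=
  ‖Matrix.toEuclideanCLM (n := Fin d) (𝕜 := ℂ) A‖

/-- A Hermitian-matrix-valued function is suitable if the real and imaginary parts of its entries
belong to the algebra `𝒜` of suitable real-valued functions. -/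
structure IsSuitableMat {Ω : Type*} {d : ℕ} (𝒜 : Subalgebra ℝ (Ω → ℝ))
    (f : Ω → Matrix (Fin d) (Fin d) ℂ) : Prop where
  isHermitian : ∀ z, (f z).IsHermitian
  re_mem : ∀ i j, (fun z => (f z i j).re) ∈ 𝒜
  im_mem : ∀ i j, (fun z => (f z i j).im) ∈ 𝒜

namespace MarkovSemigroup

variable {Ω : Type*} [MeasurableSpace Ω]

/-- `(P_t f)(z) = E[f(Z_t) | Z_0 = z]` for real-valued `f`. -/
noncomputable def act (S : MarkovSemigroup Ω) (t : NNReal) (f : Ω → ℝ) : Ω → ℝ :=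
  fun z => ∫ y, f y ∂(S.kernel t z)

/-- `(P_t f)(z) = E[f(Z_t) | Z_0 = z]` for matrix-valued `f`. -/
noncomputable def matAct (S : MarkovSemigroup Ω) {d : ℕ} (t : NNReal)
    (f : Ω → Matrix (Fin d) (Fin d) ℂ) : Ω → Matrix (Fin d) (Fin d) ℂ :=
  fun z => matExpect (S.kernel t z) f

/-- `μ` is a stationary measure. -/
def IsStationary (S : MarkovSemigroup Ω) (μ : Measure Ω) : Prop :=
  ∀ t, Kernel.Invariant (S.kernel t) μ

/-- Each `P_t` is a symmetric operator on `L²(μ)`. -/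
def IsReversible (S : MarkovSemigroup Ω) (μ : Measure Ω) : Prop :=
  ∀ (t : NNReal) (f g : Ω → ℝ), MemLp f 2 μ → MemLp g 2 μ →
    ∫ z, S.act t f z * g z ∂μ = ∫ z, f z * S.act t g z ∂μ

/-- `P_t f → E_μ f` in `L²(μ)` as `t → ∞`. -/
def IsErgodic (S : MarkovSemigroup Ω) (μ : Measure Ω) : Prop :=
  ∀ f : Ω → ℝ, MemLp f 2 μ →
    Tendsto (fun t : NNReal => eLpNorm (fun z => S.act t f z - ∫ y, f y ∂μ) 2 μ) atTop (𝓝 0)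

/-- The infinitesimal generator `(L f)(z) = lim_{t ↓ 0} ((P_t f)(z) - f(z)) / t` on real-valued
functions. -/
noncomputable def generator (S : MarkovSemigroup Ω) (f : Ω → ℝ) : Ω → ℝ :=
  fun z => limUnder (𝓝[>] (0 : NNReal)) fun t => (t : ℝ)⁻¹ • (S.act t f z - f z)

/-- The infinitesimal generator on matrix-valued functions. -/
noncomputable def matGenerator (S : MarkovSemigroup Ω) {d : ℕ}
    (f : Ω → Matrix (Fin d) (Fin d) ℂ) : Ω → Matrix (Fin d) (Fin d) ℂ :=
  fun z => limUnder (𝓝[>] (0 : NNReal)) fun t => (t : ℝ)⁻¹ • (S.matAct t f z - f z)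

/-- `𝒜` is an algebra of suitable real-valued functions (it contains the constants): the
expectations that define `P_t f` exist, the functions are square-integrable (so, `𝒜` being an
algebra, they have all moments), the limit that defines `L f` exists at every point and also in
`L²(μ)`, and `𝒜` is stable under every `P_t` and under `L`. -/
structure IsSuitable (S : MarkovSemigroup Ω) (μ : Measure Ω) (𝒜 : Subalgebra ℝ (Ω → ℝ)) :
    Prop where
  measurable : ∀ f ∈ 𝒜, Measurable f
  integrable : ∀ f ∈ 𝒜, ∀ (t : NNReal) (z : Ω), Integrable f (S.kernel t z)
  memLp : ∀ f ∈ 𝒜, MemLp f 2 μ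
  act_mem : ∀ f ∈ 𝒜, ∀ t : NNReal, S.act t f ∈ 𝒜
  exists_lim : ∀ f ∈ 𝒜, ∀ z : Ω, ∃ l : ℝ,
    Tendsto (fun t : NNReal => (t : ℝ)⁻¹ • (S.act t f z - f z)) (𝓝[>] 0) (𝓝 l)
  tendsto_L2 : ∀ f ∈ 𝒜,
    Tendsto (fun t : NNReal =>
      eLpNorm (fun z => (t : ℝ)⁻¹ • (S.act t f z - f z) - S.generator f z) 2 μ) (𝓝[>] 0) (𝓝 0)
  generator_mem : ∀ f ∈ 𝒜, S.generator f ∈ 𝒜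

/-- The matrix carré du champ `Γ(f, g) = (L(f g) - f L(g) - L(f) g) / 2`. -/
noncomputable def Gamma (S : MarkovSemigroup Ω) {d : ℕ}
    (f g : Ω → Matrix (Fin d) (Fin d) ℂ) : Ω → Matrix (Fin d) (Fin d) ℂ :=
  (1 / 2 : ℝ) • (S.matGenerator (f * g) - f * S.matGenerator g - S.matGenerator f * g)

/-- The iterated matrix carré du champ `Γ₂(f, g) = (L Γ(f, g) - Γ(f, L g) - Γ(L f, g)) / 2`. -/
noncomputable def Gamma₂ (S : MarkovSemigroup Ω) {d : ℕ}
    (f g : Ω → Matrix (Fin d) (Fin d) ℂ) : Ω → Matrix (Fin d) (Fin d) ℂ :=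
  (1 / 2 : ℝ) • (S.matGenerator (S.Gamma f g) - S.Gamma f (S.matGenerator g)
    - S.Gamma (S.matGenerator f) g)

/-- The matrix Bakry--Émery criterion: `Γ(f) ≼ c Γ₂(f)` holds `μ`-almost everywhere, for all
suitable `f` with values in the Hermitian matrices of size `d`. -/
def BakryEmery (S : MarkovSemigroup Ω) (μ : Measure Ω) (𝒜 : Subalgebra ℝ (Ω → ℝ)) (d : ℕ)
    (c : ℝ) : Prop :=
  ∀ f : Ω → Matrix (Fin d) (Fin d) ℂ, IsSuitableMat 𝒜 f →
    ∀ᵐ z ∂μ, (c • S.Gamma₂ f f z - S.Gamma f f z).PosSemidef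

/-- The variance proxy `v_f`, the `L^∞(μ)` norm of `z ↦ ‖Γ(f)(z)‖`. -/
noncomputable def varianceProxy (S : MarkovSemigroup Ω) (μ : Measure Ω) {d : ℕ}
    (f : Ω → Matrix (Fin d) (Fin d) ℂ) : ENNReal :=
  eLpNorm (fun z => specNorm (S.Gamma f f z)) ⊤ μ

end MarkovSemigroup

/-!
Let `φ(x) = x|x|^{2q-2}` and `ψ = φ'`, and let `f` be centred, so that `P_t f → 0` by ergodicity.
Then `E tr |f|^{2q} = E tr φ(f) f` is the integral over `t > 0` of `-E tr φ(f) L P_t f`. By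
reversibility the integrand is a Dirichlet form, the limit of averages of
`tr (φ(f(Z_s)) - φ(f(Z_0))) (P_t f(Z_s) - P_t f(Z_0))` over small times `s`. As `ψ` is convex, the
mean value trace inequality bounds it, for every `τ > 0`, by half of
`τ E tr Γ(f) ψ(f) + τ⁻¹ E tr Γ(P_t f) ψ(f)`. The Bakry–Émery criterion gives
`Γ(P_t f) ≼ e^{-2t/c} P_t Γ(f)`, tested against `ψ(f)`; taking `τ = e^{-t/c}`, Young's inequality
for traces bounds everything by `E tr Γ(f)^q` and a fraction of `E tr |f|^{2q}`.

The generator being unbounded, `s ↦ P_s Γ(P_{t-s} f)` need not be differentiable, even weakly.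
Functionals averaged over a short time `ε` repair this: if `m(x) = ∫₀^ε ℓ(P_u x) du`, then
`m(L x) = ℓ(P_ε x) - ℓ(x)` no longer involves the generator.
-/

section ScalarInequalities

theorem sub_le_mul_of_convexOn_deriv {φ ψ : ℝ → ℝ} (hφ : ∀ x, HasDerivAt φ (ψ x) x)
    (hψ : ConvexOn ℝ Set.univ ψ) {a b : ℝ} (hab : a ≤ b) :
    φ b - φ a ≤ (b - a) * ((ψ a + ψ b) / 2) := by
  -- The derivative of `x ↦ φ x - φ (a + b - x)` is at most `ψ a + ψ b` between `a` and `b`.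
  have deriv_le : ∀ x ∈ Set.Icc a b, ψ x + ψ (a + b - x) ≤ ψ a + ψ b := fun x hx => by
    obtain rfl | hlt := hab.eq_or_lt
    · obtain rfl : x = a := le_antisymm hx.2 hx.1
      simp
    have hlt' : 0 < b - a := sub_pos.2 hlt
    have h₁ := hψ.2 (Set.mem_univ a) (Set.mem_univ b) (div_nonneg (sub_nonneg.2 hx.2) hlt'.le)
      (div_nonneg (sub_nonneg.2 hx.1) hlt'.le) (by field_simp; ring)
    have h₂ := hψ.2 (Set.mem_univ a) (Set.mem_univ b) (div_nonneg (sub_nonneg.2 hx.1) hlt'.le)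
      (div_nonneg (sub_nonneg.2 hx.2) hlt'.le) (by field_simp; ring)
    simp only [smul_eq_mul] at h₁ h₂
    have e₁ : (b - x) / (b - a) * a + (x - a) / (b - a) * b = x := by field_simp; ring
    have e₂ : (x - a) / (b - a) * a + (b - x) / (b - a) * b = a + b - x := by field_simp; ring
    have e₃ : (b - x) / (b - a) + (x - a) / (b - a) = 1 := by field_simp; ring
    rw [e₁] at h₁
    rw [e₂] at h₂
    linear_combination h₁ + h₂ + (ψ a + ψ b) * e₃
  have hasDeriv : ∀ x, HasDerivAt (fun x => φ x - φ (a + b - x)) (ψ x + ψ (a + b - x)) x :=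
    fun x =>
      ((hφ x).fun_sub ((hφ (a + b - x)).comp_const_sub (a + b) x)).congr_deriv (sub_neg_eq_add _ _)
  have := Convex.image_sub_le_mul_sub_of_deriv_le (convex_Icc a b)
    (fun x _ => (hasDeriv x).continuousAt.continuousWithinAt)
    (fun x _ => (hasDeriv x).differentiableAt.differentiableWithinAt) (C := ψ a + ψ b)
    (fun x hx => (hasDeriv x).deriv.trans_le (deriv_le x (interior_subset hx)))
    a (Set.left_mem_Icc.2 hab) b (Set.right_mem_Icc.2 hab) hab
  simp only [add_sub_cancel_left, add_sub_cancel_right] at this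
  linarith

theorem abs_sub_le_mul_of_convexOn_deriv {φ ψ : ℝ → ℝ} (hφ : ∀ x, HasDerivAt φ (ψ x) x)
    (hψ : ConvexOn ℝ Set.univ ψ) (hψ₀ : ∀ x, 0 ≤ ψ x) (a b : ℝ) :
    |φ a - φ b| ≤ |a - b| * ((ψ a + ψ b) / 2) := by
  have hmono : Monotone φ := monotone_of_deriv_nonneg (fun x => (hφ x).differentiableAt)
    fun x => (hφ x).deriv ▸ hψ₀ x
  wlog hab : a ≤ b generalizing a b
  · rw [abs_sub_comm, abs_sub_comm a, add_comm (ψ a)]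
    exact this b a (le_of_not_ge hab)
  rw [abs_sub_comm, abs_sub_comm a, abs_of_nonneg (sub_nonneg.2 (hmono hab)),
    abs_of_nonneg (sub_nonneg.2 hab)]
  exact sub_le_mul_of_convexOn_deriv hφ hψ hab

/-- The odd function `φ(x) = x|x|^{2q-2}`, which is normalized by `x φ(x) = |x|^{2q}`. -/
noncomputable def oddPower (q x : ℝ) : ℝ := x * |x| ^ (2 * q - 2)

/-- The derivative `ψ(x) = (2q-1)|x|^{2q-2}` of `oddPower q`, the weight in the Dirichlet form
estimates. -/
noncomputable def oddPowerDeriv (q x : ℝ) : ℝ := (2 * q - 1) * |x| ^ (2 * q - 2)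

variable {q : ℝ}

theorem oddPowerDeriv_nonneg (hq : 1 ≤ q) (x : ℝ) : 0 ≤ oddPowerDeriv q x :=
  mul_nonneg (by linarith) (by positivity)

theorem abs_oddPower (hq : 1 ≤ q) (x : ℝ) : |oddPower q x| = |x| ^ (2 * q - 1) := by
  rw [oddPower, abs_mul, abs_of_nonneg (by positivity : 0 ≤ |x| ^ (2 * q - 2)),
    ← Real.rpow_one_add' (abs_nonneg x) (by linarith)]
  ring_nf

theorem mul_oddPower (hq : 1 ≤ q) (x : ℝ) : x * oddPower q x = |x| ^ (2 * q) := by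
  rw [oddPower, ← mul_assoc, ← abs_mul_abs_self, ← sq, ← Real.rpow_natCast,
    ← Real.rpow_add_of_nonneg (abs_nonneg x) (by norm_num) (by linarith)]
  norm_num

theorem continuous_abs_rpow {p : ℝ} (hp : 0 ≤ p) : Continuous fun x : ℝ => |x| ^ p :=
  continuous_abs.rpow_const fun _ => Or.inr hp

theorem continuous_oddPower (hq : 1 ≤ q) : Continuous (oddPower q) :=
  continuous_id.mul (continuous_abs_rpow (by linarith))

theorem continuous_oddPowerDeriv (hq : 1 ≤ q) : Continuous (oddPowerDeriv q) :=
  (continuous_abs_rpow (by linarith)).const_mul _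

theorem hasDerivAt_oddPower (hq : 1 ≤ q) (x : ℝ) :
    HasDerivAt (oddPower q) (oddPowerDeriv q x) x := by
  have hasDeriv_of_ne : ∀ y : ℝ, y ≠ 0 → HasDerivAt (oddPower q) (oddPowerDeriv q y) y :=
    fun y hy => by
      have hy' : |y| ≠ 0 := abs_ne_zero.2 hy
      refine ((hasDerivAt_id y).mul ((hasDerivAt_abs hy).rpow_const
        (p := 2 * q - 2) (Or.inl hy'))).congr_deriv ?_
      have hsign : y * (SignType.sign y : ℝ) = |y| := self_mul_sign y
      rw [oddPowerDeriv, Real.rpow_sub_one hy', id]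
      field_simp
      linear_combination (2 * (q - 1)) * hsign
  obtain rfl | hx := eq_or_ne x 0
  · exact hasDerivAt_of_hasDerivAt_of_ne' hasDeriv_of_ne (continuous_oddPower hq).continuousAt
      (continuous_oddPowerDeriv hq).continuousAt 0
  · exact hasDeriv_of_ne x hx

theorem convexOn_oddPowerDeriv (hq : q = 1 ∨ 3 / 2 ≤ q) :
    ConvexOn ℝ Set.univ (oddPowerDeriv q) := by
  obtain rfl | hq := hq
  · have : oddPowerDeriv 1 = fun _ => 1 := by
      funext x
      norm_num [oddPowerDeriv]
    rw [this]
    exact convexOn_const _ convex_univ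
  · have hq' : 1 ≤ 2 * q - 2 := by linarith
    refine ConvexOn.smul (c := 2 * q - 1) (by linarith)
      ⟨convex_univ, fun x _ y _ a b ha hb hab => ?_⟩
    calc |a • x + b • y| ^ (2 * q - 2) ≤ (a • |x| + b • |y|) ^ (2 * q - 2) := by
          refine Real.rpow_le_rpow (abs_nonneg _) ((abs_add_le _ _).trans_eq ?_) (by linarith)
          simp only [smul_eq_mul, abs_mul, abs_of_nonneg ha, abs_of_nonneg hb]
      _ ≤ a • |x| ^ (2 * q - 2) + b • |y| ^ (2 * q - 2) :=
          (convexOn_rpow hq').2 (abs_nonneg x) (abs_nonneg y) ha hb hab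

theorem abs_oddPower_sub_le (hq : q = 1 ∨ 3 / 2 ≤ q) (a b : ℝ) :
    |oddPower q a - oddPower q b|
      ≤ |a - b| * ((oddPowerDeriv q a + oddPowerDeriv q b) / 2) :=
  have hq₁ : 1 ≤ q := by rcases hq with rfl | hq <;> linarith
  abs_sub_le_mul_of_convexOn_deriv (hasDerivAt_oddPower hq₁) (convexOn_oddPowerDeriv hq)
    (oddPowerDeriv_nonneg hq₁) a b

theorem young_inequality_oddPowerDeriv {c x : ℝ} (hq : 1 ≤ q) (hc : 0 ≤ c) (hx : 0 ≤ x) (y : ℝ) :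
    c * x * oddPowerDeriv q y
      ≤ (c * (2 * q - 1)) ^ q / q * x ^ q + (1 - 1 / q) * |y| ^ (2 * q) := by
  have hq₀ : 0 < q := by linarith
  have hk : 0 ≤ c * (2 * q - 1) := mul_nonneg hc (by linarith)
  have amgm := Real.geom_mean_le_arith_mean2_weighted (w₁ := 1 / q) (w₂ := 1 - 1 / q)
    (p₁ := (c * (2 * q - 1) * x) ^ q) (p₂ := |y| ^ (2 * q)) (by positivity)
    (sub_nonneg.2 ((div_le_one hq₀).2 hq)) (by positivity) (by positivity) (by ring)
  rw [← Real.rpow_mul (by positivity), ← Real.rpow_mul (by positivity),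
    mul_one_div_cancel hq₀.ne', Real.rpow_one, Real.mul_rpow hk hx,
    show 2 * q * (1 - 1 / q) = 2 * q - 2 by field_simp] at amgm
  rw [oddPowerDeriv]
  linear_combination amgm

end ScalarInequalities

section EigenbasisPair

variable {n : Type*} [Fintype n] [DecidableEq n] {A B : Matrix n n ℂ}

/-- The entries of `C` with respect to the eigenbases of two Hermitian matrices `A` (columns) and
`B` (rows). -/
noncomputable def eigenEntry (hA : A.IsHermitian) (hB : B.IsHermitian) (C : Matrix n n ℂ)
    (j i : n) : ℂ :=
  (star (hB.eigenvectorUnitary : Matrix n n ℂ) * C * (hA.eigenvectorUnitary : Matrix n n ℂ)) j i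

theorem cfc_eq_eigenvectorUnitary_mul (hA : A.IsHermitian) (φ : ℝ → ℝ) :
    cfc φ A = (hA.eigenvectorUnitary : Matrix n n ℂ)
      * Matrix.diagonal (fun i => (φ (hA.eigenvalues i) : ℂ))
      * star (hA.eigenvectorUnitary : Matrix n n ℂ) := by
  rw [hA.cfc_eq, Matrix.IsHermitian.cfc, Unitary.conjStarAlgAut_apply]
  rfl

variable (hA : A.IsHermitian) (hB : B.IsHermitian)
include hA hB

theorem eigenEntry_mul_cfc (C : Matrix n n ℂ) (φ : ℝ → ℝ) (j i : n) :
    eigenEntry hA hB (C * cfc φ A) j i = φ (hA.eigenvalues i) * eigenEntry hA hB C j i := by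
  rw [eigenEntry, cfc_eq_eigenvectorUnitary_mul hA]
  simp only [Matrix.mul_assoc, Unitary.coe_star_mul_self, Matrix.mul_one]
  simp only [← Matrix.mul_assoc, Matrix.mul_diagonal]
  exact mul_comm _ _

theorem eigenEntry_cfc_mul (C : Matrix n n ℂ) (φ : ℝ → ℝ) (j i : n) :
    eigenEntry hA hB (cfc φ B * C) j i = φ (hB.eigenvalues j) * eigenEntry hA hB C j i := by
  rw [eigenEntry, cfc_eq_eigenvectorUnitary_mul hB]
  simp only [← Matrix.mul_assoc, Unitary.coe_star_mul_self, Matrix.one_mul]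
  simp only [Matrix.mul_assoc, Matrix.diagonal_mul]
  rw [eigenEntry, Matrix.mul_assoc]

theorem eigenEntry_sub (j i : n) :
    eigenEntry hA hB (A - B) j i
      = ((hA.eigenvalues i - hB.eigenvalues j : ℝ) : ℂ) * eigenEntry hA hB 1 j i := by
  have hA' := eigenEntry_mul_cfc hA hB 1 (fun x => x) j i
  have hB' := eigenEntry_cfc_mul hA hB 1 (fun x => x) j i
  rw [cfc_id' ℝ A hA.isSelfAdjoint, Matrix.one_mul] at hA'
  rw [cfc_id' ℝ B hB.isSelfAdjoint, Matrix.mul_one] at hB'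
  rw [eigenEntry, Matrix.mul_sub, Matrix.sub_mul, Matrix.sub_apply, ← eigenEntry, ← eigenEntry,
    hA', hB', Complex.ofReal_sub]
  ring

theorem trace_mul_conjTranspose_eq_sum (C D : Matrix n n ℂ) :
    (C * D.conjTranspose).trace
      = ∑ j, ∑ i, eigenEntry hA hB C j i * star (eigenEntry hA hB D j i) := by
  set U : Matrix n n ℂ := (hA.eigenvectorUnitary).1
  set V : Matrix n n ℂ := (hB.eigenvectorUnitary).1
  have trace_eq : (C * D.conjTranspose).trace
      = ((star V * C * U) * (star V * D * U).conjTranspose).trace := by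
    calc (C * D.conjTranspose).trace = (V * star V * (C * (U * star U) * star D)).trace := by
          rw [Unitary.mul_star_self_of_mem hA.eigenvectorUnitary.2,
            Unitary.mul_star_self_of_mem hB.eigenvectorUnitary.2, Matrix.one_mul, Matrix.mul_one,
            Matrix.star_eq_conjTranspose]
      _ = (star V * (C * (U * star U) * star D) * V).trace := by
          rw [Matrix.mul_assoc, Matrix.trace_mul_comm]
      _ = _ := by
          simp only [← Matrix.star_eq_conjTranspose, star_mul, star_star, Matrix.mul_assoc]
  rw [trace_eq]
  rfl

theorem re_trace_mul_cfc_left (C : Matrix n n ℂ) (φ : ℝ → ℝ) :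
    (C * cfc φ A).trace.re = ∑ j, ∑ i, φ (hA.eigenvalues i)
      * (eigenEntry hA hB C j i * star (eigenEntry hA hB 1 j i)).re := by
  have h := trace_mul_conjTranspose_eq_sum hA hB (C * cfc φ A) 1
  rw [Matrix.conjTranspose_one, Matrix.mul_one] at h
  simp only [h, Complex.re_sum, eigenEntry_mul_cfc, mul_assoc, Complex.re_ofReal_mul]

theorem re_trace_mul_cfc_right (C : Matrix n n ℂ) (φ : ℝ → ℝ) :
    (C * cfc φ B).trace.re = ∑ j, ∑ i, φ (hB.eigenvalues j)
      * (eigenEntry hA hB C j i * star (eigenEntry hA hB 1 j i)).re := by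
  have h := trace_mul_conjTranspose_eq_sum hA hB (cfc φ B * C) 1
  rw [Matrix.conjTranspose_one, Matrix.mul_one] at h
  simp only [Matrix.trace_mul_comm C, h, Complex.re_sum, eigenEntry_cfc_mul, mul_assoc,
    Complex.re_ofReal_mul]

theorem re_trace_sq_mul_cfc_left {C : Matrix n n ℂ} (hC : C.IsHermitian) (ψ : ℝ → ℝ) :
    (C * C * cfc ψ A).trace.re
      = ∑ j, ∑ i, ψ (hA.eigenvalues i) * ‖eigenEntry hA hB C j i‖ ^ 2 := by
  have h := trace_mul_conjTranspose_eq_sum hA hB (C * cfc ψ A) C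
  rw [hC.eq, Matrix.trace_mul_comm, ← Matrix.mul_assoc] at h
  rw [h]
  simp only [Complex.re_sum, eigenEntry_mul_cfc, mul_assoc, Complex.re_ofReal_mul,
    Complex.star_def, Complex.mul_conj', ← Complex.ofReal_pow, Complex.ofReal_re]

theorem re_trace_sq_mul_cfc_right {C : Matrix n n ℂ} (hC : C.IsHermitian) (ψ : ℝ → ℝ) :
    (C * C * cfc ψ B).trace.re
      = ∑ j, ∑ i, ψ (hB.eigenvalues j) * ‖eigenEntry hA hB C j i‖ ^ 2 := by
  have h := trace_mul_conjTranspose_eq_sum hA hB (cfc ψ B * C) C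
  rw [hC.eq, Matrix.mul_assoc, Matrix.trace_mul_comm] at h
  rw [h]
  simp only [Complex.re_sum, eigenEntry_cfc_mul, mul_assoc, Complex.re_ofReal_mul,
    Complex.star_def, Complex.mul_conj', ← Complex.ofReal_pow, Complex.ofReal_re]

theorem mean_value_trace_inequality {C : Matrix n n ℂ} (hC : C.IsHermitian) {φ ψ : ℝ → ℝ}
    (hφ : ∀ a b, |φ a - φ b| ≤ |a - b| * ((ψ a + ψ b) / 2)) (hψ : ∀ a, 0 ≤ ψ a)
    {τ : ℝ} (hτ : 0 < τ) :
    (C * (cfc φ A - cfc φ B)).trace.re ≤ 1 / 4 *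
      (τ * (((A - B) * (A - B) * cfc ψ A).trace.re + ((A - B) * (A - B) * cfc ψ B).trace.re)
        + τ⁻¹ * ((C * C * cfc ψ A).trace.re + (C * C * cfc ψ B).trace.re)) := by
  rw [Matrix.mul_sub, Matrix.trace_sub, Complex.sub_re, re_trace_mul_cfc_left hA hB,
    re_trace_mul_cfc_right hA hB, re_trace_sq_mul_cfc_left hA hB (hA.sub hB),
    re_trace_sq_mul_cfc_right hA hB (hA.sub hB), re_trace_sq_mul_cfc_left hA hB hC,
    re_trace_sq_mul_cfc_right hA hB hC]
  simp only [← Finset.sum_sub_distrib, ← Finset.sum_add_distrib, Finset.mul_sum]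
  refine Finset.sum_le_sum fun j _ => Finset.sum_le_sum fun i _ => ?_
  rw [eigenEntry_sub, ← sub_mul, norm_mul, Complex.norm_real, Real.norm_eq_abs]
  set a := hA.eigenvalues i
  set b := hB.eigenvalues j
  set x := eigenEntry hA hB C j i
  set y := eigenEntry hA hB 1 j i
  have re_le : (φ a - φ b) * (x * star y).re ≤ |φ a - φ b| * (‖x‖ * ‖y‖) := by
    refine (le_abs_self _).trans ?_
    rw [abs_mul, ← norm_star y, ← norm_mul]
    exact mul_le_mul_of_nonneg_left (Complex.abs_re_le_norm _) (abs_nonneg _)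
  have mean_value := mul_le_mul_of_nonneg_right (hφ a b)
    (mul_nonneg (norm_nonneg x) (norm_nonneg y))
  have amgm : 2 * ((|a - b| * ‖y‖) * ‖x‖) ≤ τ * (|a - b| * ‖y‖) ^ 2 + τ⁻¹ * ‖x‖ ^ 2 := by
    have : 0 ≤ τ⁻¹ * (τ * (|a - b| * ‖y‖) - ‖x‖) ^ 2 := by positivity
    refine sub_nonneg.1 (this.trans_eq ?_)
    field_simp
    ring
  have := mul_le_mul_of_nonneg_left amgm (add_nonneg (hψ a) (hψ b))
  linarith

omit hB in
theorem re_trace_cfc (u : ℝ → ℝ) : (cfc u A).trace.re = ∑ i, u (hA.eigenvalues i) := by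
  rw [cfc_eq_eigenvectorUnitary_mul hA, Matrix.trace_mul_cycle, Unitary.coe_star_mul_self,
    Matrix.one_mul, Matrix.trace_diagonal, Complex.re_sum]
  simp only [Complex.ofReal_re]

theorem re_trace_cfc_mul_cfc_le {x y u v : ℝ → ℝ}
    (h : ∀ i j, x (hA.eigenvalues i) * y (hB.eigenvalues j)
      ≤ u (hA.eigenvalues i) + v (hB.eigenvalues j)) :
    (cfc x A * cfc y B).trace.re ≤ (cfc u A).trace.re + (cfc v B).trace.re := by
  have hu := re_trace_mul_cfc_left hA hB 1 u
  have hv := re_trace_mul_cfc_right hA hB 1 v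
  rw [Matrix.one_mul] at hu hv
  rw [hu, hv, re_trace_mul_cfc_right hA hB, ← Matrix.one_mul (cfc x A)]
  simp only [← Finset.sum_add_distrib, eigenEntry_mul_cfc]
  refine Finset.sum_le_sum fun j _ => Finset.sum_le_sum fun i _ => ?_
  set w := eigenEntry hA hB 1 j i
  have hw : (w * star w).re = ‖w‖ ^ 2 := by
    rw [Complex.star_def, Complex.mul_conj', ← Complex.ofReal_pow, Complex.ofReal_re]
  rw [mul_assoc, Complex.re_ofReal_mul, hw]
  have := mul_le_mul_of_nonneg_right (h i j) (sq_nonneg ‖w‖)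
  linarith

end EigenbasisPair

section TraceInequalities

variable {n : Type*} [Fintype n] [DecidableEq n] {A B : Matrix n n ℂ}

theorem re_trace_mul_cfc_nonneg (hA : A.PosSemidef) (hB : B.IsHermitian) {ψ : ℝ → ℝ}
    (hψ : ∀ x, 0 ≤ ψ x) : 0 ≤ (A * cfc ψ B).trace.re := by
  have h := re_trace_cfc_mul_cfc_le hA.isHermitian hB (x := fun x => -x) (y := ψ)
    (u := fun _ => 0) (v := fun _ => 0) fun i j => by
      linarith [mul_nonneg (hA.eigenvalues_nonneg i) (hψ (hB.eigenvalues j))]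
  rw [re_trace_cfc hA.isHermitian, re_trace_cfc hB, cfc_neg_id A hA.isHermitian.isSelfAdjoint,
    Matrix.neg_mul, Matrix.trace_neg, Complex.neg_re] at h
  simpa using h

variable {q : ℝ}

theorem re_trace_mul_cfc_oddPowerDeriv_le (hA : A.PosSemidef) (hB : B.IsHermitian) {c : ℝ}
    (hc : 0 ≤ c) (hq : 1 ≤ q) :
    c * (A * cfc (oddPowerDeriv q) B).trace.re
      ≤ (c * (2 * q - 1)) ^ q / q * (cfc (fun x : ℝ => x ^ q) A).trace.re
        + (1 - 1 / q) * (cfc (fun x : ℝ => |x| ^ (2 * q)) B).trace.re := by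
  have h := re_trace_cfc_mul_cfc_le hA.isHermitian hB (x := fun x => c * x)
    (u := fun x => (c * (2 * q - 1)) ^ q / q * x ^ q)
    (v := fun y => (1 - 1 / q) * |y| ^ (2 * q)) fun i j =>
    young_inequality_oddPowerDeriv hq hc (hA.eigenvalues_nonneg i) (hB.eigenvalues j)
  rw [cfc_const_mul_id c A hA.isHermitian.isSelfAdjoint, re_trace_cfc hA.isHermitian,
    re_trace_cfc hB, Matrix.smul_mul, Matrix.trace_smul, Complex.smul_re, smul_eq_mul,
    ← Finset.mul_sum, ← Finset.mul_sum] at h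
  rwa [re_trace_cfc hA.isHermitian, re_trace_cfc hB]

theorem mul_cfc_oddPower (hA : A.IsHermitian) (hq : 1 ≤ q) :
    A * cfc (oddPower q) A = cfc (fun x : ℝ => |x| ^ (2 * q)) A := by
  conv_lhs => enter [1]; rw [← cfc_id' ℝ A hA.isSelfAdjoint]
  rw [← cfc_mul (fun x => x) (oddPower q) A continuousOn_id (continuous_oddPower hq).continuousOn]
  simp only [mul_oddPower hq]

end TraceInequalities

section MatrixFunctionEstimates

open scoped Matrix.Norms.L2Operator

variable {n : Type*} [Fintype n] [DecidableEq n]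

theorem abs_le_norm_of_mem_spectrum {A : Matrix n n ℂ} (hA : A.IsHermitian) {x : ℝ}
    (hx : x ∈ spectrum ℝ A) : |x| ≤ ‖A‖ := by
  have := norm_apply_le_norm_cfc (fun x : ℝ => x) A hx (by fun_prop) hA.isSelfAdjoint
  rwa [cfc_id' ℝ A hA.isSelfAdjoint] at this

theorem norm_cfc_le_rpow {A : Matrix n n ℂ} (hA : A.IsHermitian) {φ : ℝ → ℝ} {C p : ℝ}
    (hC : 0 ≤ C) (hp : 0 ≤ p) (hφ : ∀ x, |φ x| ≤ C * |x| ^ p) : ‖cfc φ A‖ ≤ C * ‖A‖ ^ p :=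
  norm_cfc_le (by positivity) fun x hx => (hφ x).trans <| mul_le_mul_of_nonneg_left
    (Real.rpow_le_rpow (abs_nonneg x) (abs_le_norm_of_mem_spectrum hA hx) hp) hC

theorem stronglyMeasurable_cfc {Ω : Type*} [MeasurableSpace Ω] {f : Ω → Matrix n n ℂ}
    (hf : StronglyMeasurable f) (hH : ∀ z, (f z).IsHermitian) {φ : ℝ → ℝ} (hφ : Continuous φ) :
    StronglyMeasurable fun z => cfc φ (f z) := by
  have hcont : Continuous fun A : selfAdjoint (Matrix n n ℂ) => cfc φ (A : Matrix n n ℂ) :=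
    Continuous.cfc_of_mem_nhdsSet (A := Matrix n n ℂ) (s := Set.univ) φ univ_mem
      continuous_subtype_val (fun A => A.2) hφ.continuousOn
  have hf' : StronglyMeasurable fun z => (⟨f z, hH z⟩ : selfAdjoint (Matrix n n ℂ)) :=
    (Embedding.comp_stronglyMeasurable_iff IsEmbedding.subtypeVal).1 hf
  exact hcont.comp_stronglyMeasurable hf'

end MatrixFunctionEstimates

/-- A one-parameter semigroup `P` of linear maps on an algebra, with generator `L`, that contracts
a seminorm `N` whose null space is an ideal. Time is real so that orbits can be differentiated;
nothing is required of `P t` for `t < 0`. -/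
structure IsContractionSemigroup {A : Type*} [Ring A] [Algebra ℝ A] (P : ℝ → A →ₗ[ℝ] A)
    (L : A →ₗ[ℝ] A) (N : Seminorm ℝ A) : Prop where
  zero : ∀ x, P 0 x = x
  add : ∀ s t x, 0 ≤ s → 0 ≤ t → P (s + t) x = P s (P t x)
  contraction : ∀ t x, 0 ≤ t → N (P t x) ≤ N x
  tendsto_generator : ∀ x, Tendsto (fun h : ℝ => N (h⁻¹ • (P h x - x) - L x)) (𝓝[>] 0) (𝓝 0)
  null_mul : ∀ x y, N x = 0 → N (x * y) = 0
  mul_null : ∀ x y, N y = 0 → N (x * y) = 0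

/-- The functional `ℓ` is bounded in the seminorm `N` on products one factor of which moves along
an orbit of the semigroup, uniformly along that orbit and along the orbit of the product. Although
multiplication is not `N`-continuous, this lets products be differentiated in time. -/
def IsProductBounded {A : Type*} [Ring A] [Algebra ℝ A] (P : ℝ → A →ₗ[ℝ] A)
    (N : Seminorm ℝ A) (ℓ : A →ₗ[ℝ] ℝ) : Prop :=
  ∀ y, ∃ C, 0 ≤ C ∧ ∀ u v x, 0 ≤ u → 0 ≤ v →
    |ℓ (P u (x * P v y))| ≤ C * N x ∧ |ℓ (P u (P v y * x))| ≤ C * N x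

/-- The carré du champ `Γ(x, y)` of a linear operator `L` on an algebra. -/
noncomputable def carreDuChamp {A : Type*} [Ring A] [Algebra ℝ A] (L : A →ₗ[ℝ] A) (x y : A) : A :=
  (1 / 2 : ℝ) • (L (x * y) - x * L y - L x * y)

/-- The iterated carré du champ `Γ₂(x, y)` of a linear operator `L` on an algebra. -/
noncomputable def iteratedCarreDuChamp {A : Type*} [Ring A] [Algebra ℝ A] (L : A →ₗ[ℝ] A)
    (x y : A) : A :=
  (1 / 2 : ℝ) • (L (carreDuChamp L x y) - carreDuChamp L x (L y) - carreDuChamp L (L x) y)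

theorem tendsto_sub_const_nhdsGT_zero {s : ℝ} : Tendsto (fun r => r - s) (𝓝[>] s) (𝓝[>] 0) := by
  refine tendsto_nhdsWithin_iff.2
    ⟨?_, eventually_nhdsWithin_of_forall fun r (hr : s < r) => sub_pos.2 hr⟩
  simpa only [sub_self] using ((continuous_sub_right s).tendsto s).mono_left nhdsWithin_le_nhds

theorem le_exp_neg_mul_of_mul_le_deriv_right {k k' : ℝ → ℝ} {a t : ℝ} (ht : 0 ≤ t)
    (hk : ContinuousOn k (Set.Icc 0 t))
    (hk' : ∀ s ∈ Set.Ico 0 t, HasDerivWithinAt k (k' s) (Set.Ici s) s)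
    (h : ∀ s ∈ Set.Ico 0 t, a * k s ≤ k' s) : k 0 ≤ Real.exp (-a * t) * k t := by
  have hexp (s : ℝ) : HasDerivAt (fun s => Real.exp (-a * s)) (Real.exp (-a * s) * -a) s := by
    simpa using ((hasDerivAt_id s).const_mul (-a)).exp
  have hmono := image_le_of_deriv_right_le_deriv_boundary (a := 0) (b := t)
    (f := fun s => -(Real.exp (-a * s) * k s))
    (f' := fun s => -(Real.exp (-a * s) * -a * k s + Real.exp (-a * s) * k' s))
    (B := fun _ => -k 0) (B' := 0)
    ((Continuous.continuousOn (by fun_prop)).mul hk).neg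
    (fun s hs => ((hexp s).hasDerivWithinAt.mul (hk' s hs)).neg) (by simp) (by fun_prop)
    (fun s _ => hasDerivWithinAt_const _ _ _) fun s hs => ?_
  · exact neg_le_neg_iff.1 (hmono (Set.right_mem_Icc.2 ht))
  · have := mul_le_mul_of_nonneg_left (h s hs) (Real.exp_pos (-a * s)).le
    simp only [Pi.zero_apply]
    linarith

theorem le_of_neg_deriv_right_le_exp {u u' : ℝ → ℝ} {a b : ℝ} (ha : 0 < a)
    (hu : ContinuousOn u (Set.Ici 0)) (hu' : ∀ t, 0 ≤ t → HasDerivWithinAt u (u' t) (Set.Ici t) t)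
    (h : ∀ t, 0 ≤ t → -u' t ≤ a * Real.exp (-a * t) * b) (hlim : Tendsto u atTop (𝓝 0)) :
    u 0 ≤ b := by
  have hexp (s : ℝ) : HasDerivAt (fun s => Real.exp (-a * s) * b)
      (Real.exp (-a * s) * -a * b) s := by
    simpa using (((hasDerivAt_id s).const_mul (-a)).exp).mul_const b
  have hmono : ∀ t, 0 ≤ t → Real.exp (-a * t) * b - u t ≤ b - u 0 := fun t ht =>
    image_le_of_deriv_right_le_deriv_boundary (a := 0) (b := t) (B := fun _ => b - u 0) (B' := 0)
      ((Continuous.continuousOn (by fun_prop)).sub (hu.mono Set.Icc_subset_Ici_self))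
      (fun s hs => (hexp s).hasDerivWithinAt.sub (hu' s hs.1)) (by simp) continuousOn_const
      (fun s _ => hasDerivWithinAt_const _ _ _)
      (fun s hs => by
        have := h s hs.1
        simp only [Pi.zero_apply]
        linarith) (Set.right_mem_Icc.2 ht)
  have hdecay : Tendsto (fun t => Real.exp (-a * t) * b - u t) atTop (𝓝 (0 * b - 0)) := by
    simpa only [neg_mul, Function.comp_def, id_eq] using ((Real.tendsto_exp_neg_atTop_nhds_zero.comp
      (tendsto_id.const_mul_atTop ha)).mul_const b).sub hlim
  rw [zero_mul, sub_zero] at hdecay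
  exact sub_nonneg.1 (le_of_tendsto hdecay ((eventually_ge_atTop 0).mono hmono))

theorem seminorm_sub_eq_zero {A : Type*} [AddCommGroup A] [Module ℝ A] {N : Seminorm ℝ A} {x y : A}
    (hx : N x = 0) (hy : N y = 0) : N (x - y) = 0 :=
  le_antisymm ((map_sub_le_add N x y).trans_eq (by rw [hx, hy, add_zero])) (apply_nonneg N _)

namespace IsContractionSemigroup

variable {A : Type*} [Ring A] [Algebra ℝ A] {P : ℝ → A →ₗ[ℝ] A} {L : A →ₗ[ℝ] A}
  {N : Seminorm ℝ A}

theorem eq_comp_sub (H : IsContractionSemigroup P L N) {s r : ℝ} (hs : 0 ≤ s) (hsr : s ≤ r)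
    (x : A) : P r x = P s (P (r - s) x) := by
  rw [← H.add _ _ _ hs (sub_nonneg.2 hsr), add_sub_cancel]

theorem tendsto_sub_self (H : IsContractionSemigroup P L N) (x : A) :
    Tendsto (fun h => N (P h x - x)) (𝓝[≥] 0) (𝓝 0) := by
  have hbound : Tendsto (fun h : ℝ => h * (N (h⁻¹ • (P h x - x) - L x) + N (L x))) (𝓝[>] 0)
      (𝓝 0) := by
    simpa using (tendsto_id.mono_left nhdsWithin_le_nhds).mul
      ((H.tendsto_generator x).add_const (N (L x)))
  rw [← Set.Ioi_union_left, nhdsWithin_union, tendsto_sup, nhdsWithin_singleton]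
  refine ⟨squeeze_zero' (Eventually.of_forall fun h => apply_nonneg N _) ?_ hbound,
    tendsto_pure_left.2 fun s hs => by simpa [H.zero] using mem_of_mem_nhds hs⟩
  filter_upwards [self_mem_nhdsWithin] with h (hh : 0 < h)
  calc N (P h x - x) = h * N (h⁻¹ • (P h x - x)) := by
        rw [map_smul_eq_mul, norm_inv, Real.norm_of_nonneg hh.le, mul_inv_cancel_left₀ hh.ne']
    _ ≤ h * (N (h⁻¹ • (P h x - x) - L x) + N (L x)) := by
        gcongr
        simpa using map_add_le_add N (h⁻¹ • (P h x - x) - L x) (L x)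

theorem sub_le_abs_sub (H : IsContractionSemigroup P L N) {s r : ℝ} (hs : 0 ≤ s) (hr : 0 ≤ r)
    (x : A) : N (P r x - P s x) ≤ N (P |r - s| x - x) := by
  wlog hsr : s ≤ r generalizing s r
  · rw [map_sub_rev, abs_sub_comm]
    exact this hr hs (le_of_not_ge hsr)
  rw [H.eq_comp_sub hs hsr, ← map_sub, abs_of_nonneg (sub_nonneg.2 hsr)]
  exact H.contraction _ _ hs

theorem tendsto_orbit (H : IsContractionSemigroup P L N) (x : A) {s : ℝ} (hs : 0 ≤ s) :
    Tendsto (fun r => N (P r x - P s x)) (𝓝[Set.Ici 0] s) (𝓝 0) := by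
  have habs : Tendsto (fun r => |r - s|) (𝓝[Set.Ici 0] s) (𝓝[≥] 0) := by
    refine tendsto_nhdsWithin_iff.2 ⟨?_, Eventually.of_forall fun r => abs_nonneg (r - s)⟩
    have hcont : Continuous fun r => |r - s| := by fun_prop
    simpa only [sub_self, abs_zero] using (hcont.tendsto s).mono_left nhdsWithin_le_nhds
  refine squeeze_zero' (Eventually.of_forall fun r => apply_nonneg N _) ?_
    ((H.tendsto_sub_self x).comp habs)
  filter_upwards [self_mem_nhdsWithin] with r hr
  exact H.sub_le_abs_sub hs hr x

theorem tendsto_backward_orbit (H : IsContractionSemigroup P L N) (x : A) {s t : ℝ}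
    (hst : s ≤ t) :
    Tendsto (fun r => N (P (t - r) x - P (t - s) x)) (𝓝[Set.Iic t] s) (𝓝 0) := by
  refine (H.tendsto_orbit x (sub_nonneg.2 hst)).comp (tendsto_nhdsWithin_iff.2 ⟨?_, ?_⟩)
  · exact ((continuous_sub_left t).tendsto s).mono_left nhdsWithin_le_nhds
  · exact eventually_nhdsWithin_of_forall fun r (hr : r ≤ t) => sub_nonneg.2 hr

theorem tendsto_backward_slope (H : IsContractionSemigroup P L N) (x : A) {s t : ℝ}
    (hst : s < t) :
    Tendsto (fun r => N ((r - s)⁻¹ • (P (t - s) x - P (t - r) x) - P (t - s) (L x)))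
      (𝓝[>] s) (𝓝 0) := by
  have hlt : ∀ᶠ r in 𝓝[>] s, r < t := mem_nhdsWithin_of_mem_nhds (Iio_mem_nhds hst)
  have hbound := ((H.tendsto_generator x).comp (tendsto_sub_const_nhdsGT_zero (s := s))).add
    ((H.tendsto_backward_orbit (L x) hst.le).mono_left
      (le_inf nhdsWithin_le_nhds (le_principal_iff.2 (hlt.mono fun _ => le_of_lt))))
  rw [add_zero] at hbound
  refine squeeze_zero' (Eventually.of_forall fun r => apply_nonneg N _) ?_ hbound
  filter_upwards [self_mem_nhdsWithin, hlt] with r (hsr : s < r) hrt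
  have hdecomp : (r - s)⁻¹ • (P (t - s) x - P (t - r) x) - P (t - s) (L x)
      = P (t - r) ((r - s)⁻¹ • (P (r - s) x - x) - L x)
        + (P (t - r) (L x) - P (t - s) (L x)) := by
    rw [H.eq_comp_sub (sub_nonneg.2 hrt.le) (sub_le_sub_left hsr.le t) x, sub_sub_sub_cancel_left]
    simp only [map_sub, map_smul]
    abel
  rw [hdecomp]
  exact (map_add_le_add N _ _).trans
    (add_le_add_left (H.contraction _ _ (sub_nonneg.2 hrt.le)) _)

theorem null_generator (H : IsContractionSemigroup P L N) {x : A} (hx : N x = 0) :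
    N (L x) = 0 := by
  refine tendsto_nhds_unique_of_eventuallyEq tendsto_const_nhds (H.tendsto_generator x) ?_
  filter_upwards [self_mem_nhdsWithin] with h (hh : 0 < h)
  have horbit : N (h⁻¹ • (P h x - x)) = 0 := by
    rw [map_smul_eq_mul, seminorm_sub_eq_zero (le_antisymm ?_ (apply_nonneg N _)) hx,
      mul_zero]
    exact (H.contraction h x hh.le).trans_eq hx
  refine le_antisymm ?_ ?_
  · simpa [horbit] using map_sub_le_add N (h⁻¹ • (P h x - x)) (h⁻¹ • (P h x - x) - L x)
  · simpa [horbit] using map_sub_le_add N (h⁻¹ • (P h x - x)) (L x)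

theorem generator_comm (H : IsContractionSemigroup P L N) {u : ℝ} (hu : 0 ≤ u) (x : A) :
    N (L (P u x) - P u (L x)) = 0 := by
  have hlim := (H.tendsto_generator (P u x)).add (H.tendsto_generator x)
  rw [add_zero] at hlim
  refine le_antisymm (ge_of_tendsto hlim ?_) (apply_nonneg N _)
  filter_upwards [self_mem_nhdsWithin] with h (hh : 0 < h)
  have hslope : P u (h⁻¹ • (P h x - x) - L x)
      = h⁻¹ • (P h (P u x) - P u x) - P u (L x) := by
    rw [map_sub, map_smul, map_sub, ← H.add _ _ _ hu hh.le, ← H.add _ _ _ hh.le hu, add_comm u h]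
  calc N (L (P u x) - P u (L x))
      = N (P u (h⁻¹ • (P h x - x) - L x) - (h⁻¹ • (P h (P u x) - P u x) - L (P u x))) := by
        rw [hslope, sub_sub_sub_cancel_left]
    _ ≤ N (h⁻¹ • (P h (P u x) - P u x) - L (P u x)) + N (h⁻¹ • (P h x - x) - L x) := by
        rw [add_comm]
        exact (map_sub_le_add N _ _).trans (add_le_add_left (H.contraction u _ hu) _)

theorem null_mul_sub_mul (H : IsContractionSemigroup P L N) {x x' y y' : A}
    (hx : N (x - x') = 0) (hy : N (y - y') = 0) : N (x * y - x' * y') = 0 := by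
  have hdecomp : x * y - x' * y' = (x - x') * y - x' * (y' - y) := by noncomm_ring
  rw [hdecomp]
  exact seminorm_sub_eq_zero (H.null_mul _ _ hx) (H.mul_null _ _ (by rwa [map_sub_rev]))

theorem null_carreDuChamp_sub (H : IsContractionSemigroup P L N) {x x' y y' : A}
    (hx : N (x - x') = 0) (hy : N (y - y') = 0) :
    N (carreDuChamp L x y - carreDuChamp L x' y') = 0 := by
  have hdecomp : carreDuChamp L x y - carreDuChamp L x' y' = (1 / 2 : ℝ) • (L (x * y - x' * y')
      - (x * L y - x' * L y') - (L x * y - L x' * y')) := by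
    simp only [carreDuChamp, ← smul_sub, map_sub]
    congr 1
    abel
  have hLx : N (L x - L x') = 0 := by rw [← map_sub]; exact H.null_generator hx
  have hLy : N (L y - L y') = 0 := by rw [← map_sub]; exact H.null_generator hy
  rw [hdecomp, map_smul_eq_mul, seminorm_sub_eq_zero (seminorm_sub_eq_zero
    (H.null_generator (H.null_mul_sub_mul hx hy)) (H.null_mul_sub_mul hx hLy))
    (H.null_mul_sub_mul hLx hy), mul_zero]

end IsContractionSemigroup

namespace IsProductBounded

variable {A : Type*} [Ring A] [Algebra ℝ A] {P : ℝ → A →ₗ[ℝ] A} {L : A →ₗ[ℝ] A}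
  {N : Seminorm ℝ A} {ℓ : A →ₗ[ℝ] ℝ}

theorem comp (hℓ : IsProductBounded P N ℓ) (H : IsContractionSemigroup P L N) {r : ℝ}
    (hr : 0 ≤ r) : IsProductBounded P N (ℓ ∘ₗ P r) := by
  intro y
  obtain ⟨C, hC, h⟩ := hℓ y
  refine ⟨C, hC, fun u v x hu hv => ?_⟩
  simpa only [H.add _ _ _ hr hu, LinearMap.comp_apply] using h (r + u) v x (add_nonneg hr hu) hv

theorem sub {m : A →ₗ[ℝ] ℝ} (hℓ : IsProductBounded P N ℓ) (hm : IsProductBounded P N m) :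
    IsProductBounded P N (ℓ - m) := by
  intro y
  obtain ⟨C, hC, hl⟩ := hℓ y
  obtain ⟨D, hD, hm⟩ := hm y
  refine ⟨C + D, add_nonneg hC hD, fun u v x hu hv => ⟨?_, ?_⟩⟩ <;>
    rw [LinearMap.sub_apply, add_mul]
  · exact (abs_sub _ _).trans (add_le_add (hl u v x hu hv).1 (hm u v x hu hv).1)
  · exact (abs_sub _ _).trans (add_le_add (hl u v x hu hv).2 (hm u v x hu hv).2)

theorem exists_bound (hℓ : IsProductBounded P N ℓ) (H : IsContractionSemigroup P L N) :
    ∃ C, 0 ≤ C ∧ ∀ x, |ℓ x| ≤ C * N x := by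
  obtain ⟨C, hC, h⟩ := hℓ 1
  refine ⟨C, hC, fun x => ?_⟩
  simpa only [H.zero, mul_one] using (h 0 0 x le_rfl le_rfl).1

theorem tendsto_of_null (hℓ : IsProductBounded P N ℓ) (H : IsContractionSemigroup P L N)
    {α : Type*} {l : Filter α} {x : α → A} (hx : Tendsto (fun a => N (x a)) l (𝓝 0)) :
    Tendsto (fun a => ℓ (x a)) l (𝓝 0) := by
  obtain ⟨C, -, h⟩ := hℓ.exists_bound H
  exact squeeze_zero_norm (fun a => h _) (by simpa using hx.const_mul C)

theorem congr (hℓ : IsProductBounded P N ℓ) (H : IsContractionSemigroup P L N) {x y : A}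
    (hxy : N (x - y) = 0) : ℓ x = ℓ y := by
  obtain ⟨C, -, h⟩ := hℓ.exists_bound H
  have hbound := h (x - y)
  rw [hxy, mul_zero, map_sub] at hbound
  exact sub_eq_zero.1 (abs_nonpos_iff.1 hbound)

theorem continuousOn_orbit (hℓ : IsProductBounded P N ℓ) (H : IsContractionSemigroup P L N)
    (x : A) : ContinuousOn (fun r => ℓ (P r x)) (Set.Ici 0) := by
  intro s hs
  rw [ContinuousWithinAt, ← tendsto_sub_nhds_zero_iff]
  simpa only [map_sub] using hℓ.tendsto_of_null H (H.tendsto_orbit x hs)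

theorem hasDerivWithinAt_orbit (hℓ : IsProductBounded P N ℓ) (H : IsContractionSemigroup P L N)
    (x : A) {s : ℝ} (hs : 0 ≤ s) :
    HasDerivWithinAt (fun r => ℓ (P r x)) (ℓ (P s (L x))) (Set.Ici s) s := by
  rw [← hasDerivWithinAt_Ioi_iff_Ici, hasDerivWithinAt_iff_tendsto_slope' (by simp),
    ← tendsto_sub_nhds_zero_iff]
  refine ((hℓ.comp H hs).tendsto_of_null H ((H.tendsto_generator x).comp
    (tendsto_sub_const_nhdsGT_zero (s := s)))).congr' ?_
  filter_upwards [self_mem_nhdsWithin] with r (hr : s < r)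
  simp only [slope_def_field, H.eq_comp_sub hs hr.le, LinearMap.comp_apply, map_sub, map_smul,
    smul_eq_mul]
  ring

theorem tendsto_const_mul (hℓ : IsProductBounded P N ℓ) (H : IsContractionSemigroup P L N)
    {x w : A} {Y : ℝ → A} {v s : ℝ} {l : Filter ℝ} (hv : 0 ≤ v) (hs : 0 ≤ s)
    (hl : l ≤ 𝓝[Set.Ici 0] s) (hY : Tendsto (fun r => N (Y r - w)) l (𝓝 0)) :
    Tendsto (fun r => ℓ (P r (P v x * Y r))) l (𝓝 (ℓ (P s (P v x * w)))) := by
  obtain ⟨C, -, h⟩ := hℓ x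
  have hdiff : Tendsto (fun r => ℓ (P r (P v x * (Y r - w)))) l (𝓝 0) := by
    refine squeeze_zero_norm' ?_ (by simpa using hY.const_mul C)
    filter_upwards [hl self_mem_nhdsWithin] with r hr
    exact (h r v _ hr hv).2
  simpa [mul_sub] using hdiff.add ((hℓ.continuousOn_orbit H (P v x * w) s hs).mono_left hl)

theorem tendsto_mul_orbit (hℓ : IsProductBounded P N ℓ) (H : IsContractionSemigroup P L N)
    {x y : A} {X : ℝ → A} {v s t : ℝ} {l : Filter ℝ} (hv : 0 ≤ v) (hs : 0 ≤ s) (hst : s ≤ t)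
    (hl : l ≤ 𝓝[Set.Icc 0 t] s) (hX : Tendsto (fun r => N (X r - P v x)) l (𝓝 0)) :
    Tendsto (fun r => ℓ (P r (X r * P (t - r) y))) l (𝓝 (ℓ (P s (P v x * P (t - s) y)))) := by
  obtain ⟨C, -, h⟩ := hℓ y
  have hdiff : Tendsto (fun r => ℓ (P r ((X r - P v x) * P (t - r) y))) l (𝓝 0) := by
    refine squeeze_zero_norm' ?_ (by simpa using hX.const_mul C)
    filter_upwards [hl self_mem_nhdsWithin] with r hr
    exact (h r (t - r) _ hr.1 (sub_nonneg.2 hr.2)).1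
  simpa [sub_mul] using hdiff.add (hℓ.tendsto_const_mul H (x := x) hv hs
    (hl.trans (nhdsWithin_mono s Set.Icc_subset_Ici_self))
    ((H.tendsto_backward_orbit y hst).mono_left
      (hl.trans (nhdsWithin_mono s Set.Icc_subset_Iic_self))))

theorem continuousOn_orbit_mul (hℓ : IsProductBounded P N ℓ) (H : IsContractionSemigroup P L N)
    (x y : A) (t : ℝ) :
    ContinuousOn (fun r => ℓ (P r (P (t - r) x * P (t - r) y))) (Set.Icc 0 t) :=
  fun _ hs => hℓ.tendsto_mul_orbit H (sub_nonneg.2 hs.2) hs.1 hs.2 le_rfl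
    ((H.tendsto_backward_orbit x hs.2).mono_left (nhdsWithin_mono _ Set.Icc_subset_Iic_self))

theorem two_mul_carreDuChamp_orbit (hℓ : IsProductBounded P N ℓ)
    (H : IsContractionSemigroup P L N) (x y : A) {r v : ℝ} (hr : 0 ≤ r) (hv : 0 ≤ v) :
    2 * ℓ (P r (carreDuChamp L (P v x) (P v y))) = ℓ (P r (L (P v x * P v y)))
      - ℓ (P r (P v x * P v (L y))) - ℓ (P r (P v (L x) * P v y)) := by
  have hx : (ℓ ∘ₗ P r) (L (P v x) * P v y) = (ℓ ∘ₗ P r) (P v (L x) * P v y) :=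
    (hℓ.comp H hr).congr H (H.null_mul_sub_mul (H.generator_comm hv x) (by simp))
  have hy : (ℓ ∘ₗ P r) (P v x * L (P v y)) = (ℓ ∘ₗ P r) (P v x * P v (L y)) :=
    (hℓ.comp H hr).congr H (H.null_mul_sub_mul (by simp) (H.generator_comm hv y))
  rw [LinearMap.comp_apply, LinearMap.comp_apply] at hx hy
  simp only [carreDuChamp, map_smul, map_sub, smul_eq_mul, hx, hy]
  ring

theorem hasDerivWithinAt_orbit_mul (hℓ : IsProductBounded P N ℓ)
    (H : IsContractionSemigroup P L N) (x y : A) {s t : ℝ} (hs : 0 ≤ s) (hst : s < t) :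
    HasDerivWithinAt (fun r => ℓ (P r (P (t - r) x * P (t - r) y)))
      (2 * ℓ (P s (carreDuChamp L (P (t - s) x) (P (t - s) y)))) (Set.Ici s) s := by
  have hts : 0 ≤ t - s := (sub_pos.2 hst).le
  have hl : 𝓝[>] s ≤ 𝓝[Set.Icc 0 t] s := nhdsWithin_le_of_mem <|
    mem_of_superset (Ioc_mem_nhdsGT hst) fun r hr => ⟨hs.trans hr.1.le, hr.2⟩
  have hleft := hℓ.tendsto_mul_orbit H (y := y) hts hs hst.le hl (H.tendsto_backward_slope x hst)
  have hright := hℓ.tendsto_const_mul H (x := x) hts hs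
    (hl.trans (nhdsWithin_mono s Set.Icc_subset_Ici_self)) (H.tendsto_backward_slope y hst)
  have hprod := (hasDerivWithinAt_iff_tendsto_slope' (by simp)).1
    (hℓ.hasDerivWithinAt_orbit H (P (t - s) x * P (t - s) y) hs).Ioi_of_Ici
  rw [← hasDerivWithinAt_Ioi_iff_Ici, hasDerivWithinAt_iff_tendsto_slope' (by simp),
    hℓ.two_mul_carreDuChamp_orbit H x y hs hts]
  refine ((hprod.sub hright).sub hleft).congr fun r => ?_
  simp only [slope_def_field, map_sub, map_smul, smul_sub, sub_mul, mul_sub, smul_mul_assoc,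
    mul_smul_comm, smul_eq_mul]
  ring

theorem carreDuChamp_orbit_eq (hℓ : IsProductBounded P N ℓ)
    (H : IsContractionSemigroup P L N) (x y : A) {r v : ℝ} (hr : 0 ≤ r) (hv : 0 ≤ v) :
    ℓ (P r (carreDuChamp L (P v x) (P v y))) = (1 / 2) * ((ℓ ∘ₗ L) (P r (P v x * P v y))
      - ℓ (P r (P v x * P v (L y))) - ℓ (P r (P v (L x) * P v y))) := by
  rw [LinearMap.comp_apply, hℓ.congr H (H.generator_comm hr _),
    ← hℓ.two_mul_carreDuChamp_orbit H x y hr hv]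
  ring

theorem continuousOn_carreDuChamp_orbit (hℓ : IsProductBounded P N ℓ)
    (hℓL : IsProductBounded P N (ℓ ∘ₗ L)) (H : IsContractionSemigroup P L N) (x y : A) (t : ℝ) :
    ContinuousOn (fun r => ℓ (P r (carreDuChamp L (P (t - r) x) (P (t - r) y))))
      (Set.Icc 0 t) :=
  ((((hℓL.continuousOn_orbit_mul H x y t).sub (hℓ.continuousOn_orbit_mul H x (L y) t)).sub
    (hℓ.continuousOn_orbit_mul H (L x) y t)).const_mul (1 / 2)).congr fun _ hr =>
      hℓ.carreDuChamp_orbit_eq H x y hr.1 (sub_nonneg.2 hr.2)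

theorem hasDerivWithinAt_carreDuChamp_orbit (hℓ : IsProductBounded P N ℓ)
    (hℓL : IsProductBounded P N (ℓ ∘ₗ L)) (H : IsContractionSemigroup P L N) (x y : A) {s t : ℝ}
    (hs : 0 ≤ s) (hst : s < t) :
    HasDerivWithinAt (fun r => ℓ (P r (carreDuChamp L (P (t - r) x) (P (t - r) y))))
      (2 * ℓ (P s (iteratedCarreDuChamp L (P (t - s) x) (P (t - s) y)))) (Set.Ici s) s := by
  have hts : 0 ≤ t - s := (sub_pos.2 hst).le
  have hx : (ℓ ∘ₗ P s) (carreDuChamp L (L (P (t - s) x)) (P (t - s) y))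
      = (ℓ ∘ₗ P s) (carreDuChamp L (P (t - s) (L x)) (P (t - s) y)) :=
    (hℓ.comp H hs).congr H (H.null_carreDuChamp_sub (H.generator_comm hts x) (by simp))
  have hy : (ℓ ∘ₗ P s) (carreDuChamp L (P (t - s) x) (L (P (t - s) y)))
      = (ℓ ∘ₗ P s) (carreDuChamp L (P (t - s) x) (P (t - s) (L y))) :=
    (hℓ.comp H hs).congr H (H.null_carreDuChamp_sub (by simp) (H.generator_comm hts y))
  have hderiv := (((hℓL.hasDerivWithinAt_orbit_mul H x y hs hst).sub
    (hℓ.hasDerivWithinAt_orbit_mul H x (L y) hs hst)).sub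
    (hℓ.hasDerivWithinAt_orbit_mul H (L x) y hs hst)).const_mul (1 / 2)
  refine (hderiv.congr_of_eventuallyEq ?_
    (hℓ.carreDuChamp_orbit_eq H x y hs hts)).congr_deriv ?_
  · filter_upwards [Icc_mem_nhdsGE hst] with r hr
    exact hℓ.carreDuChamp_orbit_eq H x y (hs.trans hr.1) (sub_nonneg.2 hr.2)
  · rw [LinearMap.comp_apply, LinearMap.comp_apply] at hx hy
    rw [LinearMap.comp_apply, hℓ.congr H (H.generator_comm hs _)]
    simp only [iteratedCarreDuChamp, map_smul, map_sub, smul_eq_mul, hx, hy]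
    ring

theorem carreDuChamp_semigroup_le_of_comp_generator (hℓ : IsProductBounded P N ℓ)
    (hℓL : IsProductBounded P N (ℓ ∘ₗ L)) (H : IsContractionSemigroup P L N) (x y : A) {c t : ℝ}
    (hc : 0 < c) (ht : 0 ≤ t)
    (h : ∀ s v, 0 ≤ s → 0 ≤ v → ℓ (P s (carreDuChamp L (P v x) (P v y)))
      ≤ c * ℓ (P s (iteratedCarreDuChamp L (P v x) (P v y)))) :
    ℓ (carreDuChamp L (P t x) (P t y))
      ≤ Real.exp (-(2 / c) * t) * ℓ (P t (carreDuChamp L x y)) := by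
  have hgronwall := le_exp_neg_mul_of_mul_le_deriv_right (a := 2 / c) ht
    (hℓ.continuousOn_carreDuChamp_orbit hℓL H x y t)
    (fun s hs => hℓ.hasDerivWithinAt_carreDuChamp_orbit hℓL H x y hs.1 hs.2) fun s hs => by
      rw [div_mul_eq_mul_div, div_le_iff₀ hc]
      linarith [h s (t - s) hs.1 (sub_nonneg.2 hs.2.le)]
  simpa only [sub_zero, sub_self, H.zero] using hgronwall

theorem intervalIntegrable_orbit (hℓ : IsProductBounded P N ℓ)
    (H : IsContractionSemigroup P L N) (x : A) {ε : ℝ} (hε : 0 ≤ ε) :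
    IntervalIntegrable (fun u => ℓ (P u x)) volume 0 ε :=
  ((hℓ.continuousOn_orbit H x).mono (by
    rw [Set.uIcc_of_le hε]; exact Set.Icc_subset_Ici_self)).intervalIntegrable

/-- The time average `x ↦ ∫₀^ε ℓ (P u x) du` of a functional along the semigroup. Unlike `ℓ`, it
stays product-bounded after composition with the generator. -/
noncomputable def timeAverage (hℓ : IsProductBounded P N ℓ) (H : IsContractionSemigroup P L N)
    {ε : ℝ} (hε : 0 ≤ ε) : A →ₗ[ℝ] ℝ where
  toFun x := ∫ u in (0 : ℝ)..ε, ℓ (P u x)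
  map_add' x y := by
    simp only [map_add]
    exact intervalIntegral.integral_add (hℓ.intervalIntegrable_orbit H x hε)
      (hℓ.intervalIntegrable_orbit H y hε)
  map_smul' r x := by
    simp only [map_smul, RingHom.id_apply, intervalIntegral.integral_smul]

theorem abs_timeAverage_le (hℓ : IsProductBounded P N ℓ) (H : IsContractionSemigroup P L N)
    {ε K : ℝ} (hε : 0 ≤ ε) {x : A} (h : ∀ r, 0 ≤ r → |ℓ (P r x)| ≤ K) :
    |hℓ.timeAverage H hε x| ≤ ε * K := by
  have hbound := intervalIntegral.norm_integral_le_of_norm_le_const (a := 0) (b := ε)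
    (f := fun r => ℓ (P r x)) (C := K) fun r hr => h r (by
      rw [Set.uIoc_of_le hε] at hr
      exact hr.1.le)
  rwa [sub_zero, abs_of_nonneg hε, mul_comm] at hbound

theorem timeAverage_isProductBounded (hℓ : IsProductBounded P N ℓ)
    (H : IsContractionSemigroup P L N) {ε : ℝ} (hε : 0 ≤ ε) :
    IsProductBounded P N (hℓ.timeAverage H hε) := by
  intro y
  obtain ⟨C, hC, h⟩ := hℓ y
  refine ⟨ε * C, mul_nonneg hε hC, fun u v x hu hv => ⟨?_, ?_⟩⟩ <;> rw [mul_assoc] <;>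
    refine hℓ.abs_timeAverage_le H hε fun r hr => ?_ <;> rw [← H.add _ _ _ hr hu]
  · exact (h (r + u) v x (add_nonneg hr hu) hv).1
  · exact (h (r + u) v x (add_nonneg hr hu) hv).2

theorem timeAverage_comp_generator (hℓ : IsProductBounded P N ℓ)
    (H : IsContractionSemigroup P L N) {ε : ℝ} (hε : 0 ≤ ε) :
    hℓ.timeAverage H hε ∘ₗ L = ℓ ∘ₗ P ε - ℓ := by
  ext x
  have hftc := intervalIntegral.integral_eq_sub_of_hasDeriv_right (a := 0) (b := ε)
    (f := fun r => ℓ (P r x)) (f' := fun r => ℓ (P r (L x)))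
    ((hℓ.continuousOn_orbit H x).mono (by rw [Set.uIcc_of_le hε]; exact Set.Icc_subset_Ici_self))
    (fun r hr => (hℓ.hasDerivWithinAt_orbit H x (by
      rw [min_eq_left hε] at hr
      exact hr.1.le)).mono Set.Ioi_subset_Ici_self)
    (hℓ.intervalIntegrable_orbit H _ hε)
  rwa [H.zero] at hftc

theorem le_of_timeAverage_le (hℓ : IsProductBounded P N ℓ) (H : IsContractionSemigroup P L N)
    {x y : A}
    (h : ∀ ε (hε : 0 ≤ ε), hℓ.timeAverage H hε x ≤ hℓ.timeAverage H hε y) : ℓ x ≤ ℓ y := by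
  by_contra! hlt
  have hcont := (hℓ.continuousOn_orbit H (x - y)) 0 (Set.mem_Ici.2 le_rfl)
  have hpos : ∀ᶠ r in 𝓝[≥] (0 : ℝ), 0 < ℓ (P r (x - y)) :=
    hcont.eventually_const_lt (by simp only [H.zero, map_sub]; linarith)
  obtain ⟨δ, hδ : 0 < δ, hsub⟩ := mem_nhdsGE_iff_exists_Icc_subset.1 hpos
  have hint : 0 < hℓ.timeAverage H hδ.le (x - y) :=
    intervalIntegral.intervalIntegral_pos_of_pos_on (hℓ.intervalIntegrable_orbit H _ hδ.le)
      (fun r hr => hsub ⟨hr.1.le, hr.2.le⟩) hδ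
  rw [map_sub] at hint
  linarith [h δ hδ.le]

theorem carreDuChamp_semigroup_le (hℓ : IsProductBounded P N ℓ)
    (H : IsContractionSemigroup P L N) (x y : A) {c t : ℝ} (hc : 0 < c) (ht : 0 ≤ t)
    (h : ∀ s v, 0 ≤ s → 0 ≤ v → ℓ (P s (carreDuChamp L (P v x) (P v y)))
      ≤ c * ℓ (P s (iteratedCarreDuChamp L (P v x) (P v y)))) :
    ℓ (carreDuChamp L (P t x) (P t y))
      ≤ Real.exp (-(2 / c) * t) * ℓ (P t (carreDuChamp L x y)) := by
  rw [← smul_eq_mul, ← map_smul]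
  refine hℓ.le_of_timeAverage_le H fun ε hε => ?_
  rw [map_smul, smul_eq_mul]
  refine (hℓ.timeAverage_isProductBounded H hε).carreDuChamp_semigroup_le_of_comp_generator
    (by rw [hℓ.timeAverage_comp_generator H hε]; exact (hℓ.comp H hε).sub hℓ) H x y hc ht
    fun s v hs hv => ?_
  rw [← smul_eq_mul, ← map_smul]
  refine intervalIntegral.integral_mono_on hε (hℓ.intervalIntegrable_orbit H _ hε)
    (hℓ.intervalIntegrable_orbit H _ hε) fun u hu => ?_
  simp only [map_smul, smul_eq_mul, ← H.add _ _ _ hu.1 hs]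
  exact h (u + s) v (add_nonneg hu.1 hs) hv

theorem tendsto_carreDuChamp (hℓ : IsProductBounded P N ℓ) (H : IsContractionSemigroup P L N)
    (x y : A) :
    Tendsto (fun h => (2 * h)⁻¹ * ℓ (P h (x * y) - x * P h y - P h x * y + x * y)) (𝓝[>] 0)
      (𝓝 (ℓ (carreDuChamp L x y))) := by
  obtain ⟨C, -, hx⟩ := hℓ x
  obtain ⟨D, -, hy⟩ := hℓ y
  have hright : Tendsto (fun h : ℝ => ℓ (x * (h⁻¹ • (P h y - y) - L y))) (𝓝[>] 0) (𝓝 0) :=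
    squeeze_zero_norm (fun h => by
      simpa only [H.zero, Real.norm_eq_abs] using (hx 0 0 _ le_rfl le_rfl).2)
      (by simpa using (H.tendsto_generator y).const_mul C)
  have hleft : Tendsto (fun h : ℝ => ℓ ((h⁻¹ • (P h x - x) - L x) * y)) (𝓝[>] 0) (𝓝 0) :=
    squeeze_zero_norm (fun h => by
      simpa only [H.zero, Real.norm_eq_abs] using (hy 0 0 _ le_rfl le_rfl).1)
      (by simpa using (H.tendsto_generator x).const_mul D)
  have hlim := ((((hℓ.tendsto_of_null H (H.tendsto_generator (x * y))).sub hright).sub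
    hleft).const_mul (1 / 2)).add_const (ℓ (carreDuChamp L x y))
  simp only [sub_zero, mul_zero, zero_add] at hlim
  refine hlim.congr fun h => ?_
  simp only [carreDuChamp, map_sub, map_add, map_smul, mul_sub, sub_mul, mul_smul_comm,
    smul_mul_assoc, smul_eq_mul, mul_inv]
  ring

end IsProductBounded

section FiniteDimensional

variable {E : Type*} [NormedAddCommGroup E] [NormedSpace ℝ E] [FiniteDimensional ℝ E]

theorem exists_tendsto_of_dual {α : Type*} {l : Filter α} {u : α → E}
    (hu : ∀ ℓ : Module.Dual ℝ E, ∃ a, Tendsto (fun t => ℓ (u t)) l (𝓝 a)) :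
    ∃ x, Tendsto u l (𝓝 x) := by
  let b := Module.finBasis ℝ E
  choose a ha using fun i => hu (b.coord i)
  refine ⟨∑ i, a i • b i, ?_⟩
  refine (tendsto_finsetSum _ fun i _ => (ha i).smul_const (b i)).congr fun t => ?_
  exact b.sum_repr (u t)

variable {Ω : Type*} [MeasurableSpace Ω]

theorem stronglyMeasurable_of_dual {X : Ω → E}
    (hX : ∀ ℓ : Module.Dual ℝ E, Measurable fun z => ℓ (X z)) : StronglyMeasurable X := by
  let b := Module.finBasis ℝ E
  have expand : X = fun z => ∑ i, b.coord i (X z) • b i := funext fun z => (b.sum_repr (X z)).symm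
  rw [expand]
  exact Finset.stronglyMeasurable_fun_sum _ fun i _ =>
    (hX (b.coord i)).stronglyMeasurable.smul_const (b i)

theorem memLp_of_dual {ν : Measure Ω} {p : ENNReal} {X : Ω → E}
    (hX : ∀ ℓ : Module.Dual ℝ E, MemLp (fun z => ℓ (X z)) p ν) : MemLp X p ν := by
  let b := Module.finBasis ℝ E
  have expand : X = fun z => ∑ i, b.coord i (X z) • b i := funext fun z => (b.sum_repr (X z)).symm
  rw [expand]
  exact memLp_finsetSum _ fun i _ =>
    (ContinuousLinearMap.toSpanSingleton ℝ (b i)).comp_memLp' (hX (b.coord i))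

theorem tendsto_eLpNorm_of_dual {ν : Measure Ω} {p : ENNReal} (hp : 1 ≤ p) {α : Type*}
    {l : Filter α} {X : α → Ω → E}
    (hm : ∀ (ℓ : Module.Dual ℝ E) (a : α), Measurable fun z => ℓ (X a z))
    (hX : ∀ ℓ : Module.Dual ℝ E, Tendsto (fun a => eLpNorm (fun z => ℓ (X a z)) p ν) l (𝓝 0)) :
    Tendsto (fun a => eLpNorm (X a) p ν) l (𝓝 0) := by
  let b := Module.finBasis ℝ E
  have le_sum : ∀ a, eLpNorm (X a) p ν
      ≤ ∑ i, ‖b i‖ₑ * eLpNorm (fun z => b.coord i (X a z)) p ν := fun a => by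
    have expand : X a = ∑ i, fun z => b.coord i (X a z) • b i :=
      funext fun z => by rw [Finset.sum_apply]; exact (b.sum_repr (X a z)).symm
    conv_lhs => rw [expand]
    refine (eLpNorm_sum_le (fun i _ =>
      ((hm (b.coord i) a).stronglyMeasurable.smul_const (b i)).aestronglyMeasurable) hp).trans
        (Finset.sum_le_sum fun i _ => ?_)
    exact eLpNorm_le_nnreal_smul_eLpNorm_of_ae_le_mul (Eventually.of_forall fun z => by
      rw [nnnorm_smul, mul_comm]) _
  refine tendsto_of_tendsto_of_tendsto_of_le_of_le tendsto_const_nhds ?_ (fun a => zero_le) le_sum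
  simpa using tendsto_finsetSum Finset.univ fun i _ =>
    ENNReal.Tendsto.const_mul (hX (b.coord i)) (Or.inr (enorm_ne_top (x := b i)))

end FiniteDimensional

section CoordinateAlgebra

variable {Ω M : Type*} [Ring M] [Algebra ℝ M] [FiniteDimensional ℝ M]

/-- The algebra of `M`-valued functions, all of whose real coordinates belong to `𝒜`; for complex
matrices this means the real and imaginary parts of all the entries. Testing against every linear
functional keeps the definition independent of a basis. -/
def coordinateAlgebra (𝒜 : Subalgebra ℝ (Ω → ℝ)) (M : Type*) [Ring M] [Algebra ℝ M]
    [FiniteDimensional ℝ M] : Subalgebra ℝ (Ω → M) where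
  carrier := {X | ∀ ℓ : Module.Dual ℝ M, (fun z => ℓ (X z)) ∈ 𝒜}
  add_mem' hX hY ℓ := by
    simp only [Pi.add_apply, map_add]
    exact 𝒜.add_mem (hX ℓ) (hY ℓ)
  mul_mem' {X Y} hX hY ℓ := by
    let b := Module.finBasis ℝ M
    have expand : (fun z => ℓ ((X * Y) z)) = ∑ i, ∑ j,
        ℓ (b i * b j) • ((fun z => b.coord i (X z)) * fun z => b.coord j (Y z)) := by
      funext z
      rw [Pi.mul_apply]
      conv_lhs => rw [← b.sum_repr (X z), ← b.sum_repr (Y z), Finset.sum_mul_sum]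
      simp only [map_sum, Finset.sum_apply, Pi.smul_apply, Pi.mul_apply, smul_mul_smul_comm,
        map_smul, smul_eq_mul, Module.Basis.coord_apply, mul_comm]
    rw [expand]
    exact 𝒜.sum_mem fun i _ => 𝒜.sum_mem fun j _ =>
      𝒜.smul_mem (𝒜.mul_mem (hX (b.coord i)) (hY (b.coord j))) _
  algebraMap_mem' r ℓ := 𝒜.algebraMap_mem (ℓ (algebraMap ℝ M r))

/-- The algebra of suitable functions with values in the complex matrices of size `d`. -/
noncomputable abbrev matAlgebra (𝒜 : Subalgebra ℝ (Ω → ℝ)) (d : ℕ) :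
    Subalgebra ℝ (Ω → Matrix (Fin d) (Fin d) ℂ) :=
  coordinateAlgebra 𝒜 (Matrix (Fin d) (Fin d) ℂ)

variable {𝒜 : Subalgebra ℝ (Ω → ℝ)}

theorem const_mem_coordinateAlgebra (x : M) : (fun _ => x) ∈ coordinateAlgebra 𝒜 M :=
  fun ℓ => 𝒜.algebraMap_mem (ℓ x)

variable {d : ℕ} {f : Ω → Matrix (Fin d) (Fin d) ℂ}

theorem isSuitableMat_iff : IsSuitableMat 𝒜 f ↔
    (∀ z, (f z).IsHermitian) ∧ f ∈ matAlgebra 𝒜 d := by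
  refine ⟨fun hf => ⟨hf.isHermitian, fun ℓ => ?_⟩, fun hf => ⟨hf.1,
    fun i j => hf.2 (Complex.reLm ∘ₗ Matrix.entryLinearMap ℝ ℂ i j),
    fun i j => hf.2 (Complex.imLm ∘ₗ Matrix.entryLinearMap ℝ ℂ i j)⟩⟩
  have expand : (fun z => ℓ (f z)) = ∑ i, ∑ j,
      (ℓ (Matrix.single i j 1) • (fun z => (f z i j).re)
        + ℓ (Matrix.single i j Complex.I) • fun z => (f z i j).im) := by
    funext z
    have single_eq : ∀ i j, Matrix.single i j (f z i j)
        = (f z i j).re • Matrix.single i j 1 + (f z i j).im • Matrix.single i j Complex.I :=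
      fun i j => by
        rw [Matrix.smul_single, Matrix.smul_single, ← Matrix.single_add, Complex.real_smul,
          Complex.real_smul, mul_one, Complex.re_add_im]
    conv_lhs => rw [Matrix.matrix_eq_sum_single (f z)]
    simp only [single_eq, map_sum, map_add, map_smul, Finset.sum_apply, Pi.add_apply,
      Pi.smul_apply, smul_eq_mul, mul_comm]
  rw [expand]
  exact 𝒜.sum_mem fun i _ => 𝒜.sum_mem fun j _ =>
    𝒜.add_mem (𝒜.smul_mem (hf.re_mem i j) _) (𝒜.smul_mem (hf.im_mem i j) _)

end CoordinateAlgebra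

section Kernels

variable {Ω Ω' E : Type*} [MeasurableSpace Ω] [MeasurableSpace Ω'] [NormedAddCommGroup E]
  [NormedSpace ℝ E]

theorem eLpNorm_integral_kernel_le {μ : Measure Ω} {κ : Kernel Ω Ω'} [IsMarkovKernel κ]
    {X : Ω' → E} (hX : StronglyMeasurable X) {p : ENNReal} (hp : 1 ≤ p) (hp' : p ≠ ⊤) :
    eLpNorm (fun z => ∫ y, X y ∂κ z) p μ ≤ eLpNorm X p (κ ∘ₘ μ) := by
  have hp₀ : p ≠ 0 := (zero_lt_one.trans_le hp).ne'
  have hpr : 0 < p.toReal := ENNReal.toReal_pos hp₀ hp'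
  have jensen : ∀ z, ‖∫ y, X y ∂κ z‖ₑ ^ p.toReal ≤ ∫⁻ y, ‖X y‖ₑ ^ p.toReal ∂κ z := fun z => by
    calc ‖∫ y, X y ∂κ z‖ₑ ^ p.toReal ≤ eLpNorm X p (κ z) ^ p.toReal := by
          refine ENNReal.rpow_le_rpow ?_ hpr.le
          exact (enorm_integral_le_lintegral_enorm _).trans
            (eLpNorm_one_eq_lintegral_enorm.symm.le.trans
              (eLpNorm_le_eLpNorm_of_exponent_le hp hX.aestronglyMeasurable))
      _ = _ := by
          rw [eLpNorm_eq_lintegral_rpow_enorm_toReal hp₀ hp', ← ENNReal.rpow_mul, one_div,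
            inv_mul_cancel₀ hpr.ne', ENNReal.rpow_one]
  rw [eLpNorm_eq_lintegral_rpow_enorm_toReal hp₀ hp',
    eLpNorm_eq_lintegral_rpow_enorm_toReal hp₀ hp',
    Measure.lintegral_bind κ.measurable.aemeasurable (hX.enorm.pow_const _).aemeasurable]
  exact ENNReal.rpow_le_rpow (lintegral_mono jensen) (by positivity)

end Kernels

theorem memLp_of_forall_pow_mem {Ω : Type*} [MeasurableSpace Ω] {μ : Measure Ω}
    [IsFiniteMeasure μ] {a : Ω → ℝ} (ha : AEStronglyMeasurable a μ)
    (hpow : ∀ n : ℕ, MemLp (a ^ n) 2 μ) {p : ENNReal} (hp : p ≠ ⊤) : MemLp a p μ := by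
  obtain ⟨n, hn⟩ := ENNReal.exists_nat_gt hp
  have hN : ((n + 1 : ℕ) : ENNReal) ≠ 0 := by simp
  have h := (memLp_norm_rpow_iff (q := (n + 1 : ℕ)) (p := 2 * (n + 1 : ℕ)) ha hN (by simp)).1 (by
    rw [ENNReal.mul_div_cancel_right hN (by simp)]
    refine (memLp_congr_norm (hpow (n + 1)).1 ?_ (Eventually.of_forall fun z => ?_)).1
      (hpow (n + 1))
    · exact (ha.norm.aemeasurable.pow_const _).aestronglyMeasurable
    · rw [Pi.pow_apply, ENNReal.toReal_natCast, Real.rpow_natCast, norm_pow, norm_pow, norm_norm])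
  refine h.mono_exponent (hn.le.trans ?_)
  calc (n : ENNReal) ≤ 1 * (n + 1 : ℕ) := by simp
    _ ≤ 2 * (n + 1 : ℕ) := by gcongr; exact one_le_two

open scoped Matrix.Norms.L2Operator in
theorem matExpect_eq_integral {Ω : Type*} [MeasurableSpace Ω] {d : ℕ} {ν : Measure Ω}
    {X : Ω → Matrix (Fin d) (Fin d) ℂ} (hX : Integrable X ν) :
    matExpect ν X = ∫ y, X y ∂ν := by
  ext i j
  exact (Matrix.entryLinearMap ℝ ℂ i j).toContinuousLinearMap.integral_comp_comm hX

namespace MarkovSemigroup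

open scoped Matrix.Norms.L2Operator

variable {Ω : Type*} [MeasurableSpace Ω] {S : MarkovSemigroup Ω} {μ : Measure Ω}
  {𝒜 : Subalgebra ℝ (Ω → ℝ)} {d : ℕ} {X : Ω → Matrix (Fin d) (Fin d) ℂ}

namespace IsSuitable

variable (h𝒜 : S.IsSuitable μ 𝒜)
include h𝒜

theorem memLp_of_ne_top [IsFiniteMeasure μ] {a : Ω → ℝ} (ha : a ∈ 𝒜) {p : ENNReal}
    (hp : p ≠ ⊤) : MemLp a p μ :=
  memLp_of_forall_pow_mem (h𝒜.measurable a ha).aestronglyMeasurable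
    (fun n => h𝒜.memLp _ (𝒜.pow_mem ha n)) hp

theorem tendsto_generator {a : Ω → ℝ} (ha : a ∈ 𝒜) (z : Ω) :
    Tendsto (fun t : NNReal => (t : ℝ)⁻¹ • (S.act t a z - a z)) (𝓝[>] 0)
      (𝓝 (S.generator a z)) :=
  tendsto_nhds_limUnder (h𝒜.exists_lim a ha z)

variable (hX : X ∈ matAlgebra 𝒜 d)
include hX

theorem mat_stronglyMeasurable : StronglyMeasurable X :=
  stronglyMeasurable_of_dual fun ℓ => h𝒜.measurable _ (hX ℓ)

theorem mat_memLp [IsFiniteMeasure μ] {p : ENNReal} (hp : p ≠ ⊤) : MemLp X p μ :=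
  memLp_of_dual fun ℓ => h𝒜.memLp_of_ne_top (hX ℓ) hp

theorem mat_integrable (t : NNReal) (z : Ω) : Integrable X (S.kernel t z) :=
  memLp_one_iff_integrable.1 <| memLp_of_dual fun ℓ =>
    memLp_one_iff_integrable.2 (h𝒜.integrable _ (hX ℓ) t z)

theorem matAct_eq_integral (t : NNReal) (z : Ω) : S.matAct t X z = ∫ y, X y ∂S.kernel t z :=
  matExpect_eq_integral (h𝒜.mat_integrable hX t z)

theorem dual_matAct (ℓ : Module.Dual ℝ (Matrix (Fin d) (Fin d) ℂ)) (t : NNReal) (z : Ω) :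
    ℓ (S.matAct t X z) = S.act t (fun y => ℓ (X y)) z := by
  rw [h𝒜.matAct_eq_integral hX]
  exact (ℓ.toContinuousLinearMap.integral_comp_comm (h𝒜.mat_integrable hX t z)).symm

theorem matAct_mem (t : NNReal) :
    S.matAct t X ∈ matAlgebra 𝒜 d := fun ℓ => by
  simp only [h𝒜.dual_matAct hX]
  exact h𝒜.act_mem _ (hX ℓ) t

theorem dual_matAct_slope (ℓ : Module.Dual ℝ (Matrix (Fin d) (Fin d) ℂ)) (t : NNReal) (z : Ω) :
    ℓ ((t : ℝ)⁻¹ • (S.matAct t X z - X z))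
      = (t : ℝ)⁻¹ • (S.act t (fun y => ℓ (X y)) z - ℓ (X z)) := by
  rw [map_smul, map_sub, h𝒜.dual_matAct hX]

theorem tendsto_matGenerator (z : Ω) :
    Tendsto (fun t : NNReal => (t : ℝ)⁻¹ • (S.matAct t X z - X z)) (𝓝[>] 0)
      (𝓝 (S.matGenerator X z)) := by
  refine tendsto_nhds_limUnder (exists_tendsto_of_dual fun ℓ => ?_)
  simp only [h𝒜.dual_matAct_slope hX]
  exact h𝒜.exists_lim _ (hX ℓ) z

theorem dual_matGenerator (ℓ : Module.Dual ℝ (Matrix (Fin d) (Fin d) ℂ)) (z : Ω) :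
    ℓ (S.matGenerator X z) = S.generator (fun y => ℓ (X y)) z := by
  have h := (ℓ.toContinuousLinearMap.continuous.tendsto _).comp (h𝒜.tendsto_matGenerator hX z)
  simp only [Function.comp_def, LinearMap.coe_toContinuousLinearMap',
    h𝒜.dual_matAct_slope hX] at h
  exact tendsto_nhds_unique h (h𝒜.tendsto_generator (hX ℓ) z)

theorem matGenerator_mem :
    S.matGenerator X ∈ matAlgebra 𝒜 d := fun ℓ => by
  simp only [h𝒜.dual_matGenerator hX]
  exact h𝒜.generator_mem _ (hX ℓ)

theorem tendsto_matGenerator_L2 :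
    Tendsto (fun t : NNReal => eLpNorm ((t : ℝ)⁻¹ • (S.matAct t X - X) - S.matGenerator X) 2 μ)
      (𝓝[>] 0) (𝓝 0) := by
  have mem : ∀ t : NNReal, (t : ℝ)⁻¹ • (S.matAct t X - X) - S.matGenerator X
      ∈ matAlgebra 𝒜 d := fun t =>
    Subalgebra.sub_mem _ (Subalgebra.smul_mem _ (Subalgebra.sub_mem _ (h𝒜.matAct_mem hX t) hX) _)
      (h𝒜.matGenerator_mem hX)
  refine tendsto_eLpNorm_of_dual one_le_two (fun ℓ t => h𝒜.measurable _ (mem t ℓ)) fun ℓ => ?_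
  refine (h𝒜.tendsto_L2 _ (hX ℓ)).congr fun t => ?_
  simp only [Pi.sub_apply, Pi.smul_apply, map_sub, map_smul, h𝒜.dual_matAct hX,
    h𝒜.dual_matGenerator hX]

end IsSuitable

end MarkovSemigroup

section TracePairing

open scoped Matrix.Norms.L2Operator

variable {n : Type*} [Fintype n]

theorem re_trace_mul_comm (A B : Matrix n n ℂ) : (A * B).trace.re = (B * A).trace.re := by
  rw [Matrix.trace_mul_comm]

/-- The real part of the trace, as a continuous linear functional on complex matrices. -/
noncomputable def reTrace (n : Type*) [Fintype n] : Matrix n n ℂ →L[ℝ] ℝ :=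
  LinearMap.toContinuousLinearMap (Complex.reLm ∘ₗ Matrix.traceLinearMap n ℝ ℂ)

instance holderTriple_four_four : ENNReal.HolderTriple 4 4 2 := by
  constructor
  rw [← ENNReal.toReal_eq_toReal_iff' (by simp) (by simp), ENNReal.toReal_add (by simp) (by simp)]
  norm_num

variable [DecidableEq n] {Ω : Type*} [MeasurableSpace Ω] {μ : Measure Ω} {X Y : Ω → Matrix n n ℂ}

theorem integrable_re_trace_mul (hX : MemLp X 2 μ) (hY : MemLp Y 2 μ) :
    Integrable (fun z => (X z * Y z).trace.re) μ :=
  (reTrace n).integrable_comp (hX.integrable_mul hY)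

theorem integral_re_trace_mul (A : Matrix n n ℂ) (hX : Integrable X μ) :
    ∫ z, (A * X z).trace.re ∂μ = (A * ∫ z, X z ∂μ).trace.re :=
  ((reTrace n).comp (ContinuousLinearMap.mul ℝ _ A)).integral_comp_comm hX

theorem eLpNorm_mul_le {p q r : ENNReal} [ENNReal.HolderTriple p q r]
    (hX : AEStronglyMeasurable X μ) (hY : AEStronglyMeasurable Y μ) :
    eLpNorm (X * Y) r μ ≤ eLpNorm X p μ * eLpNorm Y q μ :=
  eLpNorm_smul_le_mul_eLpNorm (p := p) (q := q) (r := r) (f := Y) (φ := X) hY hX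

theorem abs_integral_re_trace_mul_le (hX : MemLp X 2 μ) (hY : MemLp Y 2 μ) :
    |∫ z, (X z * Y z).trace.re ∂μ|
      ≤ ‖reTrace n‖ * ((eLpNorm X 2 μ).toReal * (eLpNorm Y 2 μ).toReal) := by
  have holder : eLpNorm (X * Y) 1 μ ≤ eLpNorm X 2 μ * eLpNorm Y 2 μ :=
    eLpNorm_mul_le hX.1 hY.1
  calc |∫ z, (X z * Y z).trace.re ∂μ| = ‖reTrace n (∫ z, (X * Y) z ∂μ)‖ :=
        congrArg abs ((reTrace n).integral_comp_comm (hX.integrable_mul hY))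
    _ ≤ ‖reTrace n‖ * ‖∫ z, (X * Y) z ∂μ‖ := (reTrace n).le_opNorm _
    _ ≤ ‖reTrace n‖ * (eLpNorm X 2 μ * eLpNorm Y 2 μ).toReal := by
        refine mul_le_mul_of_nonneg_left ?_ (norm_nonneg _)
        rw [← toReal_enorm]
        refine ENNReal.toReal_mono (ENNReal.mul_ne_top hX.2.ne hY.2.ne) ?_
        exact (enorm_integral_le_lintegral_enorm _).trans
          (eLpNorm_one_eq_lintegral_enorm.symm.le.trans holder)
    _ = _ := by rw [ENNReal.toReal_mul]

theorem abs_integral_re_trace_mul_mul_le {Z : Ω → Matrix n n ℂ} (hX : MemLp X 4 μ)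
    (hY : MemLp Y 4 μ) (hZ : MemLp Z 2 μ) :
    |∫ z, (X z * Y z * Z z).trace.re ∂μ| ≤ ‖reTrace n‖ *
      ((eLpNorm X 4 μ).toReal * (eLpNorm Y 4 μ).toReal * (eLpNorm Z 2 μ).toReal) := by
  refine (abs_integral_re_trace_mul_le (hY.mul hX (r := 2)) hZ).trans ?_
  have holder : eLpNorm (X * Y) 2 μ ≤ eLpNorm X 4 μ * eLpNorm Y 4 μ :=
    eLpNorm_mul_le hX.1 hY.1
  rw [← ENNReal.toReal_mul (a := eLpNorm X 4 μ)]
  gcongr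
  exact ENNReal.mul_ne_top hX.2.ne hY.2.ne

end TracePairing

theorem integral_comp_of_measurePreserving {Ω Ω' E : Type*} [MeasurableSpace Ω] [MeasurableSpace Ω']
    [NormedAddCommGroup E] [NormedSpace ℝ E] {μ : Measure Ω} {π : Measure Ω'} {X : Ω' → Ω}
    (hX : MeasurePreserving X π μ) {g : Ω → E} (hg : AEStronglyMeasurable g μ) :
    ∫ p, g (X p) ∂π = ∫ z, g z ∂μ := by
  rw [← hX.map_eq] at hg ⊢
  exact (integral_map hX.aemeasurable hg).symm

namespace MarkovSemigroup

variable {Ω : Type*} [MeasurableSpace Ω] {S : MarkovSemigroup Ω} {μ : Measure Ω}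

attribute [instance] isMarkov

/-- The joint law of `(Z_0, Z_t)` when `Z_0` has law `μ`. -/
noncomputable abbrev jointLaw (S : MarkovSemigroup Ω) (μ : Measure Ω) (t : NNReal) :
    Measure (Ω × Ω) :=
  μ ⊗ₘ S.kernel t

theorem measurePreserving_fst [SFinite μ] (t : NNReal) :
    MeasurePreserving Prod.fst (S.jointLaw μ t) μ :=
  ⟨measurable_fst, Measure.fst_compProd μ (S.kernel t)⟩

theorem IsStationary.measurePreserving_snd [SFinite μ] (hstat : S.IsStationary μ) (t : NNReal) :
    MeasurePreserving Prod.snd (S.jointLaw μ t) μ :=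
  ⟨measurable_snd, (Measure.snd_compProd μ (S.kernel t)).trans (hstat t)⟩

theorem setLIntegral_kernel [IsFiniteMeasure μ] (t : NNReal) {s u : Set Ω}
    (hs : MeasurableSet s) (hu : MeasurableSet u) :
    ∫⁻ z in s, S.kernel t z u ∂μ = ENNReal.ofReal
      (∫ z, s.indicator (fun _ => (1 : ℝ)) z * S.act t (u.indicator fun _ => (1 : ℝ)) z ∂μ) := by
  have indicator_mul_act : ∀ z, s.indicator (fun _ => (1 : ℝ)) z
      * S.act t (u.indicator fun _ => (1 : ℝ)) z
      = s.indicator (fun z => (S.kernel t z).real u) z := fun z => by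
    rw [act, integral_indicator_const _ hu, smul_eq_mul, mul_one]
    by_cases hz : z ∈ s <;> simp [hz]
  have integrable_real : Integrable (fun z => (S.kernel t z).real u) (μ.restrict s) := by
    refine Integrable.of_bound ?_ 1 (Eventually.of_forall fun z => ?_)
    · exact ((S.kernel t).measurable_coe hu).ennreal_toReal.aestronglyMeasurable
    · rw [Real.norm_of_nonneg measureReal_nonneg]
      exact measureReal_le_one
  simp only [indicator_mul_act]
  rw [integral_indicator hs, ofReal_integral_eq_lintegral_ofReal integrable_real
    (Eventually.of_forall fun z => measureReal_nonneg)]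
  exact lintegral_congr fun z => (ENNReal.ofReal_toReal (measure_ne_top _ _)).symm

namespace IsReversible

variable [IsFiniteMeasure μ] (hrev : S.IsReversible μ) (t : NNReal)
include hrev

theorem measurePreserving_swap :
    MeasurePreserving Prod.swap (S.jointLaw μ t) (S.jointLaw μ t) := by
  refine ⟨measurable_swap, Measure.ext_prod fun {s u} hs hu => ?_⟩
  have memLp_indicator {v : Set Ω} (hv : MeasurableSet v) :
      MemLp (v.indicator fun _ => (1 : ℝ)) 2 μ := (memLp_const (1 : ℝ)).indicator hv
  rw [Measure.map_apply measurable_swap (hs.prod hu), Set.preimage_swap_prod,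
    Measure.compProd_apply_prod hu hs, Measure.compProd_apply_prod hs hu,
    setLIntegral_kernel t hu hs, setLIntegral_kernel t hs hu,
    ← hrev t _ _ (memLp_indicator hu) (memLp_indicator hs)]
  simp only [mul_comm]

theorem isStationary : S.IsStationary μ := fun t =>
  (Measure.snd_compProd μ (S.kernel t)).symm.trans
    ((measurePreserving_fst t).comp (hrev.measurePreserving_swap t)).map_eq

theorem integral_swap (a : Ω × Ω → ℝ) :
    ∫ p, a p.swap ∂S.jointLaw μ t = ∫ p, a p ∂S.jointLaw μ t :=
  (hrev.measurePreserving_swap t).integral_comp' (f := MeasurableEquiv.prodComm) a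

end IsReversible

end MarkovSemigroup

theorem tendsto_toNNReal_nhdsGT_zero :
    Tendsto Real.toNNReal (𝓝[>] (0 : ℝ)) (𝓝[>] (0 : NNReal)) := by
  refine tendsto_nhdsWithin_iff.2 ⟨?_, ?_⟩
  · refine Tendsto.mono_left ?_ nhdsWithin_le_nhds
    simpa only [Real.toNNReal_zero] using continuous_real_toNNReal.tendsto 0
  · filter_upwards [self_mem_nhdsWithin] with r hr using Real.toNNReal_pos.2 hr

theorem memLp_two_of_four {Ω E : Type*} [MeasurableSpace Ω] [NormedAddCommGroup E] {μ : Measure Ω}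
    [IsFiniteMeasure μ] {V : Ω → E} (hV : MemLp V 4 μ) : MemLp V 2 μ :=
  hV.mono_exponent (by norm_num)

namespace MarkovSemigroup.IsSuitable

open scoped Matrix.Norms.L2Operator

variable {Ω : Type*} [MeasurableSpace Ω] {S : MarkovSemigroup Ω} {μ : Measure Ω}
  {𝒜 : Subalgebra ℝ (Ω → ℝ)} {d : ℕ} {X Y : Ω → Matrix (Fin d) (Fin d) ℂ}

section LinearMaps

theorem matAct_add (h𝒜 : S.IsSuitable μ 𝒜) (hX : X ∈ matAlgebra 𝒜 d) (hY : Y ∈ matAlgebra 𝒜 d)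
    (t : NNReal) (z : Ω) : S.matAct t (X + Y) z = S.matAct t X z + S.matAct t Y z := by
  rw [h𝒜.matAct_eq_integral hX, h𝒜.matAct_eq_integral hY,
    h𝒜.matAct_eq_integral (Subalgebra.add_mem _ hX hY)]
  exact integral_add (h𝒜.mat_integrable hX t z) (h𝒜.mat_integrable hY t z)

theorem matAct_smul (h𝒜 : S.IsSuitable μ 𝒜) (hX : X ∈ matAlgebra 𝒜 d) (r : ℝ) (t : NNReal)
    (z : Ω) : S.matAct t (r • X) z = r • S.matAct t X z := by
  rw [h𝒜.matAct_eq_integral hX, h𝒜.matAct_eq_integral (Subalgebra.smul_mem _ hX r)]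
  exact integral_smul r _

/-- The semigroup as linear maps on suitable matrix-valued functions. The time is a real number
because the calculus of `IsContractionSemigroup` differentiates in it; negative times are sent
to `0`. -/
noncomputable def semigroupMap (h𝒜 : S.IsSuitable μ 𝒜) (d : ℕ) (t : ℝ) :
    matAlgebra 𝒜 d →ₗ[ℝ] matAlgebra 𝒜 d where
  toFun X := ⟨S.matAct t.toNNReal X.1, h𝒜.matAct_mem X.2 _⟩
  map_add' X Y := Subtype.ext (funext fun z => h𝒜.matAct_add X.2 Y.2 _ z)
  map_smul' r X := Subtype.ext (funext fun z => h𝒜.matAct_smul X.2 r _ z)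

theorem semigroupMap_apply (h𝒜 : S.IsSuitable μ 𝒜) (t : ℝ) (X : matAlgebra 𝒜 d) (z : Ω) :
    (h𝒜.semigroupMap d t X).1 z = ∫ y, X.1 y ∂S.kernel t.toNNReal z :=
  h𝒜.matAct_eq_integral X.2 _ z

/-- The generator as a linear map on suitable matrix-valued functions. -/
noncomputable def generatorMap (h𝒜 : S.IsSuitable μ 𝒜) (d : ℕ) :
    matAlgebra 𝒜 d →ₗ[ℝ] matAlgebra 𝒜 d where
  toFun X := ⟨S.matGenerator X.1, h𝒜.matGenerator_mem X.2⟩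
  map_add' X Y := Subtype.ext <| funext fun z =>
    tendsto_nhds_unique (h𝒜.tendsto_matGenerator (X + Y).2 z)
      (((h𝒜.tendsto_matGenerator X.2 z).add (h𝒜.tendsto_matGenerator Y.2 z)).congr fun t => by
        rw [Subalgebra.coe_add, h𝒜.matAct_add X.2 Y.2, Pi.add_apply, add_sub_add_comm, smul_add])
  map_smul' r X := Subtype.ext <| funext fun z =>
    tendsto_nhds_unique (h𝒜.tendsto_matGenerator (r • X).2 z)
      (((h𝒜.tendsto_matGenerator X.2 z).const_smul r).congr fun t => by
        rw [SetLike.val_smul, h𝒜.matAct_smul X.2, Pi.smul_apply, ← smul_sub, smul_comm])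

variable [IsFiniteMeasure μ]

/-- The class in `L²(μ)` of a suitable matrix-valued function. -/
noncomputable def toL2 (h𝒜 : S.IsSuitable μ 𝒜) (d : ℕ) :
    matAlgebra 𝒜 d →ₗ[ℝ] Lp (Matrix (Fin d) (Fin d) ℂ) 2 μ where
  toFun X := (h𝒜.mat_memLp X.2 (by simp)).toLp X.1
  map_add' X Y := MemLp.toLp_add (h𝒜.mat_memLp X.2 (by simp)) (h𝒜.mat_memLp Y.2 (by simp))
  map_smul' r X := MemLp.toLp_const_smul r (h𝒜.mat_memLp X.2 (by simp))

/-- The `L²(μ)` seminorm on suitable matrix-valued functions. -/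
noncomputable def seminormL2 (h𝒜 : S.IsSuitable μ 𝒜) (d : ℕ) : Seminorm ℝ (matAlgebra 𝒜 d) :=
  (normSeminorm ℝ (Lp (Matrix (Fin d) (Fin d) ℂ) 2 μ)).comp (h𝒜.toL2 d)

theorem seminormL2_apply (h𝒜 : S.IsSuitable μ 𝒜) (X : matAlgebra 𝒜 d) :
    h𝒜.seminormL2 d X = (eLpNorm X.1 2 μ).toReal :=
  Lp.norm_toLp X.1 (h𝒜.mat_memLp X.2 (p := 2) (by simp))

theorem seminormL2_eq_zero_iff (h𝒜 : S.IsSuitable μ 𝒜) (X : matAlgebra 𝒜 d) :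
    h𝒜.seminormL2 d X = 0 ↔ X.1 =ᵐ[μ] 0 := by
  have hX := h𝒜.mat_memLp X.2 (p := 2) (by simp)
  rw [seminormL2_apply, ENNReal.toReal_eq_zero_iff, or_iff_left hX.2.ne,
    eLpNorm_eq_zero_iff hX.1 (by simp)]

end LinearMaps

theorem eLpNorm_matAct_le (h𝒜 : S.IsSuitable μ 𝒜) (hstat : S.IsStationary μ)
    (hX : X ∈ matAlgebra 𝒜 d) (t : NNReal) {p : ENNReal} (hp : 1 ≤ p) (hp' : p ≠ ⊤) :
    eLpNorm (S.matAct t X) p μ ≤ eLpNorm X p μ := by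
  rw [funext (h𝒜.matAct_eq_integral hX t)]
  exact (eLpNorm_integral_kernel_le (h𝒜.mat_stronglyMeasurable hX) hp hp').trans_eq
    (by rw [hstat t])

theorem isContractionSemigroup [IsFiniteMeasure μ] (h𝒜 : S.IsSuitable μ 𝒜)
    (hstat : S.IsStationary μ) (d : ℕ) :
    IsContractionSemigroup (h𝒜.semigroupMap d) (h𝒜.generatorMap d) (h𝒜.seminormL2 d) where
  zero X := Subtype.ext <| funext fun z => by
    rw [semigroupMap_apply, Real.toNNReal_zero, S.kernel_zero, Kernel.id_apply]
    exact integral_dirac' _ _ (h𝒜.mat_stronglyMeasurable X.2)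
  add s t X hs ht := Subtype.ext <| funext fun z => by
    have hX := h𝒜.mat_integrable X.2 (s + t).toNNReal z
    simp only [semigroupMap_apply]
    rw [Real.toNNReal_add hs ht, S.kernel_add] at hX ⊢
    exact Kernel.integral_comp hX
  contraction t X _ := by
    simp only [seminormL2_apply]
    exact ENNReal.toReal_mono (h𝒜.mat_memLp X.2 (by simp)).2.ne
      (h𝒜.eLpNorm_matAct_le hstat X.2 _ one_le_two (by simp))
  tendsto_generator X := by
    have h := (ENNReal.tendsto_toReal ENNReal.zero_ne_top).comp
      ((h𝒜.tendsto_matGenerator_L2 X.2).comp tendsto_toNNReal_nhdsGT_zero)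
    rw [ENNReal.toReal_zero] at h
    refine h.congr' ?_
    filter_upwards [self_mem_nhdsWithin] with r (hr : 0 < r)
    simp only [Function.comp_apply, Real.coe_toNNReal r hr.le, seminormL2_apply]
    rfl
  null_mul X Y hX := by
    rw [seminormL2_eq_zero_iff] at hX ⊢
    filter_upwards [hX] with z hz
    rw [Subalgebra.coe_mul, Pi.mul_apply, hz, Pi.zero_apply, zero_mul]
  mul_null X Y hY := by
    rw [seminormL2_eq_zero_iff] at hY ⊢
    filter_upwards [hY] with z hz
    rw [Subalgebra.coe_mul, Pi.mul_apply, hz, Pi.zero_apply, mul_zero]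

section Pairing

variable [IsFiniteMeasure μ] {W : Ω → Matrix (Fin d) (Fin d) ℂ}

/-- The functional `X ↦ E_μ Re tr (W X)` on suitable matrix-valued functions. -/
noncomputable def pairing (h𝒜 : S.IsSuitable μ 𝒜) (hW : MemLp W 4 μ) :
    matAlgebra 𝒜 d →ₗ[ℝ] ℝ where
  toFun X := ∫ z, (W z * X.1 z).trace.re ∂μ
  map_add' X Y := by
    rw [← integral_add (integrable_re_trace_mul (memLp_two_of_four hW) (h𝒜.mat_memLp X.2 (by simp)))
      (integrable_re_trace_mul (memLp_two_of_four hW) (h𝒜.mat_memLp Y.2 (by simp)))]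
    simp only [Subalgebra.coe_add, Pi.add_apply, mul_add, Matrix.trace_add, Complex.add_re]
  map_smul' r X := by
    rw [RingHom.id_apply, smul_eq_mul, ← integral_const_mul]
    simp only [SetLike.val_smul, Pi.smul_apply, Matrix.mul_smul, Matrix.trace_smul,
      Complex.smul_re, smul_eq_mul]

theorem pairing_apply (h𝒜 : S.IsSuitable μ 𝒜) (hW : MemLp W 4 μ) (X : matAlgebra 𝒜 d) :
    h𝒜.pairing hW X = ∫ z, (W z * X.1 z).trace.re ∂μ := rfl

theorem pairing_semigroupMap (h𝒜 : S.IsSuitable μ 𝒜) (hstat : S.IsStationary μ)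
    (hW : MemLp W 4 μ) (t : ℝ) (X : matAlgebra 𝒜 d) :
    h𝒜.pairing hW (h𝒜.semigroupMap d t X)
      = ∫ p, (W p.1 * X.1 p.2).trace.re ∂S.jointLaw μ t.toNNReal := by
  have integrable_pair : Integrable (fun p : Ω × Ω => (W p.1 * X.1 p.2).trace.re)
      (S.jointLaw μ t.toNNReal) := integrable_re_trace_mul
    ((memLp_two_of_four hW).comp_measurePreserving (measurePreserving_fst _))
    ((h𝒜.mat_memLp X.2 (by simp)).comp_measurePreserving (hstat.measurePreserving_snd _))
  rw [Measure.integral_compProd integrable_pair, pairing_apply]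
  simp only [semigroupMap_apply]
  exact integral_congr_ae (Eventually.of_forall fun z =>
    (integral_re_trace_mul _ (h𝒜.mat_integrable X.2 _ z)).symm)

theorem pairing_semigroupMap_nonneg (h𝒜 : S.IsSuitable μ 𝒜) (hstat : S.IsStationary μ)
    (hW : MemLp W 4 μ) (hpos : ∀ z A, A.PosSemidef → 0 ≤ (W z * A).trace.re) (t : ℝ)
    (X : matAlgebra 𝒜 d) (hX : ∀ᵐ z ∂μ, (X.1 z).PosSemidef) :
    0 ≤ h𝒜.pairing hW (h𝒜.semigroupMap d t X) := by
  rw [h𝒜.pairing_semigroupMap hstat]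
  refine integral_nonneg_of_ae ?_
  filter_upwards [(hstat.measurePreserving_snd t.toNNReal).quasiMeasurePreserving.ae hX] with p hp
  exact hpos _ _ hp

theorem abs_pairing_semigroupMap_mul_le (h𝒜 : S.IsSuitable μ 𝒜) (hstat : S.IsStationary μ)
    (hW : MemLp W 4 μ) (u : ℝ) (V X : matAlgebra 𝒜 d) :
    |h𝒜.pairing hW (h𝒜.semigroupMap d u (X * V))| ≤ ‖reTrace (Fin d)‖ *
        ((eLpNorm V.1 4 μ).toReal * (eLpNorm W 4 μ).toReal * (eLpNorm X.1 2 μ).toReal) ∧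
      |h𝒜.pairing hW (h𝒜.semigroupMap d u (V * X))| ≤ ‖reTrace (Fin d)‖ *
        ((eLpNorm W 4 μ).toReal * (eLpNorm V.1 4 μ).toReal * (eLpNorm X.1 2 μ).toReal) := by
  have fst_preserving := measurePreserving_fst (S := S) (μ := μ) u.toNNReal
  have snd_preserving := hstat.measurePreserving_snd u.toNNReal
  have hX : MemLp X.1 2 μ := h𝒜.mat_memLp X.2 (by simp)
  have hV : MemLp V.1 4 μ := h𝒜.mat_memLp V.2 (by simp)
  have hW₁ := hW.comp_measurePreserving fst_preserving
  have hX₂ := hX.comp_measurePreserving snd_preserving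
  have hV₂ := hV.comp_measurePreserving snd_preserving
  rw [h𝒜.pairing_semigroupMap hstat, h𝒜.pairing_semigroupMap hstat,
    ← eLpNorm_comp_measurePreserving hW.1 fst_preserving,
    ← eLpNorm_comp_measurePreserving hV.1 snd_preserving,
    ← eLpNorm_comp_measurePreserving hX.1 snd_preserving]
  constructor
  · refine le_of_eq_of_le ?_ (abs_integral_re_trace_mul_mul_le hV₂ hW₁ hX₂)
    congr! 4 with p
    rw [Subalgebra.coe_mul, Pi.mul_apply, ← mul_assoc, Matrix.trace_mul_comm, ← mul_assoc]
    rfl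
  · refine le_of_eq_of_le ?_ (abs_integral_re_trace_mul_mul_le hW₁ hV₂ hX₂)
    congr! 4 with p
    rw [Subalgebra.coe_mul, Pi.mul_apply, ← mul_assoc]
    rfl

theorem isProductBounded_pairing (h𝒜 : S.IsSuitable μ 𝒜) (hstat : S.IsStationary μ)
    (hW : MemLp W 4 μ) :
    IsProductBounded (h𝒜.semigroupMap d) (h𝒜.seminormL2 d) (h𝒜.pairing hW) := by
  intro Y
  refine ⟨‖reTrace (Fin d)‖ * ((eLpNorm W 4 μ).toReal * (eLpNorm Y.1 4 μ).toReal), by positivity,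
    fun u v X _ _ => ?_⟩
  have norm_le : (eLpNorm (h𝒜.semigroupMap d v Y).1 4 μ).toReal ≤ (eLpNorm Y.1 4 μ).toReal :=
    ENNReal.toReal_mono (h𝒜.mat_memLp Y.2 (by simp)).2.ne
      (h𝒜.eLpNorm_matAct_le hstat Y.2 _ (by norm_num) (by simp))
  obtain ⟨bound_right, bound_left⟩ :=
    h𝒜.abs_pairing_semigroupMap_mul_le hstat hW u (h𝒜.semigroupMap d v Y) X
  rw [seminormL2_apply, mul_assoc]
  refine ⟨bound_right.trans ?_, bound_left.trans ?_⟩ <;>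
    refine mul_le_mul_of_nonneg_left (mul_le_mul_of_nonneg_right ?_ ENNReal.toReal_nonneg)
      (norm_nonneg _)
  · rw [mul_comm]
    exact mul_le_mul_of_nonneg_left norm_le ENNReal.toReal_nonneg
  · exact mul_le_mul_of_nonneg_left norm_le ENNReal.toReal_nonneg

end Pairing

end MarkovSemigroup.IsSuitable

namespace MarkovSemigroup

open scoped Matrix.Norms.L2Operator

section DirichletForm

variable {Ω n : Type*} [Fintype n]

/-- The squared increment `(X(y) - X(z))²` along a pair `(z, y)` of states. -/
def sqIncrement (X : Ω → Matrix n n ℂ) (p : Ω × Ω) : Matrix n n ℂ :=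
  (X p.2 - X p.1) * (X p.2 - X p.1)

theorem sqIncrement_swap (X : Ω → Matrix n n ℂ) (p : Ω × Ω) :
    sqIncrement X p.swap = sqIncrement X p := by
  rw [sqIncrement, ← neg_sub, neg_mul_neg]
  rfl

variable [MeasurableSpace Ω] [DecidableEq n] {S : MarkovSemigroup Ω} {μ : Measure Ω}
  [IsFiniteMeasure μ] {F X W : Ω → Matrix n n ℂ}

namespace IsStationary

variable (hstat : S.IsStationary μ) (t : NNReal)
include hstat

theorem memLp_increment {p : ENNReal} (hX : MemLp X p μ) :
    MemLp (fun p => X p.2 - X p.1) p (S.jointLaw μ t) :=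
  (hX.comp_measurePreserving (hstat.measurePreserving_snd t)).sub
    (hX.comp_measurePreserving (measurePreserving_fst t))

theorem integrable_sqIncrement_mul_fst (hX : MemLp X 4 μ) (hW : MemLp W 4 μ) :
    Integrable (fun p : Ω × Ω => (sqIncrement X p * W p.1).trace.re) (S.jointLaw μ t) :=
  integrable_re_trace_mul
    ((hstat.memLp_increment t hX).mul (hstat.memLp_increment t hX) (r := 2))
    ((memLp_two_of_four hW).comp_measurePreserving (measurePreserving_fst t))

end IsStationary

namespace IsReversible

variable (hrev : S.IsReversible μ) (t : NNReal)
include hrev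

theorem integral_increment_mul_increment (hX : MemLp X 2 μ) (hW : MemLp W 2 μ) :
    ∫ p, ((X p.2 - X p.1) * (W p.2 - W p.1)).trace.re ∂S.jointLaw μ t
      = 2 * (∫ z, (W z * X z).trace.re ∂μ - ∫ p, (W p.1 * X p.2).trace.re ∂S.jointLaw μ t) := by
  have fst_preserving := measurePreserving_fst (S := S) (μ := μ) t
  have snd_preserving := hrev.isStationary.measurePreserving_snd t
  have hX₁ := hX.comp_measurePreserving fst_preserving
  have hX₂ := hX.comp_measurePreserving snd_preserving
  have hW₁ := hW.comp_measurePreserving fst_preserving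
  have hW₂ := hW.comp_measurePreserving snd_preserving
  have expand : ∀ p : Ω × Ω, ((X p.2 - X p.1) * (W p.2 - W p.1)).trace.re
      = (W p.2 * X p.2).trace.re - (W p.1 * X p.2).trace.re
        - ((W p.2 * X p.1).trace.re - (W p.1 * X p.1).trace.re) := fun p => by
    rw [re_trace_mul_comm]
    simp only [mul_sub, sub_mul, Matrix.trace_sub, Complex.sub_re]
  have integral_cross : ∫ p, (W p.2 * X p.1).trace.re ∂S.jointLaw μ t
      = ∫ p, (W p.1 * X p.2).trace.re ∂S.jointLaw μ t :=
    hrev.integral_swap t fun p => (W p.1 * X p.2).trace.re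
  have split := integral_sub
    ((integrable_re_trace_mul hW₂ hX₂).sub (integrable_re_trace_mul hW₁ hX₂))
    ((integrable_re_trace_mul hW₂ hX₁).sub (integrable_re_trace_mul hW₁ hX₁))
  simp only [expand]
  refine split.trans ?_
  rw [integral_sub' (integrable_re_trace_mul hW₂ hX₂) (integrable_re_trace_mul hW₁ hX₂),
    integral_sub' (integrable_re_trace_mul hW₂ hX₁) (integrable_re_trace_mul hW₁ hX₁)]
  simp only [Function.comp_apply]
  rw [integral_comp_of_measurePreserving snd_preserving (integrable_re_trace_mul hW hX).1,
    integral_comp_of_measurePreserving fst_preserving (integrable_re_trace_mul hW hX).1,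
    integral_cross]
  ring

theorem integrable_sqIncrement_mul_snd (hX : MemLp X 4 μ) (hW : MemLp W 4 μ) :
    Integrable (fun p : Ω × Ω => (sqIncrement X p * W p.2).trace.re) (S.jointLaw μ t) := by
  refine ((hrev.measurePreserving_swap t).integrable_comp_of_integrable
    (hrev.isStationary.integrable_sqIncrement_mul_fst t hX hW)).congr
      (Eventually.of_forall fun p => ?_)
  simp only [Function.comp_apply, sqIncrement_swap, Prod.fst_swap]

omit [DecidableEq n] in
theorem integral_sqIncrement_mul_snd (X W : Ω → Matrix n n ℂ) :
    ∫ p, (sqIncrement X p * W p.2).trace.re ∂S.jointLaw μ t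
      = ∫ p, (sqIncrement X p * W p.1).trace.re ∂S.jointLaw μ t := by
  rw [← hrev.integral_swap t]
  simp only [sqIncrement_swap, Prod.snd_swap]

theorem integral_increment_mul_cfc_increment_le (hF : ∀ z, (F z).IsHermitian)
    (hX : ∀ z, (X z).IsHermitian) {φ ψ : ℝ → ℝ}
    (hφ : ∀ a b, |φ a - φ b| ≤ |a - b| * ((ψ a + ψ b) / 2)) (hψ : ∀ a, 0 ≤ ψ a)
    (hF₄ : MemLp F 4 μ) (hX₄ : MemLp X 4 μ) (hφF : MemLp (fun z => cfc φ (F z)) 4 μ)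
    (hψF : MemLp (fun z => cfc ψ (F z)) 4 μ) {τ : ℝ} (hτ : 0 < τ) :
    ∫ p, ((X p.2 - X p.1) * (cfc φ (F p.2) - cfc φ (F p.1))).trace.re ∂S.jointLaw μ t
      ≤ 1 / 2 * (τ * ∫ p, (sqIncrement F p * cfc ψ (F p.1)).trace.re ∂S.jointLaw μ t
        + τ⁻¹ * ∫ p, (sqIncrement X p * cfc ψ (F p.1)).trace.re ∂S.jointLaw μ t) := by
  have integrable_sum {Y : Ω → Matrix n n ℂ} (hY : MemLp Y 4 μ) (r : ℝ) :
      Integrable (fun p : Ω × Ω => r * ((sqIncrement Y p * cfc ψ (F p.2)).trace.re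
        + (sqIncrement Y p * cfc ψ (F p.1)).trace.re)) (S.jointLaw μ t) :=
    ((hrev.integrable_sqIncrement_mul_snd t hY hψF).add
      (hrev.isStationary.integrable_sqIncrement_mul_fst t hY hψF)).const_mul r
  have integral_sum {Y : Ω → Matrix n n ℂ} (hY : MemLp Y 4 μ) :
      ∫ p, ((sqIncrement Y p * cfc ψ (F p.2)).trace.re
        + (sqIncrement Y p * cfc ψ (F p.1)).trace.re) ∂S.jointLaw μ t
      = 2 * ∫ p, (sqIncrement Y p * cfc ψ (F p.1)).trace.re ∂S.jointLaw μ t := by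
    rw [integral_add (hrev.integrable_sqIncrement_mul_snd t hY hψF)
      (hrev.isStationary.integrable_sqIncrement_mul_fst t hY hψF),
      hrev.integral_sqIncrement_mul_snd t Y fun z => cfc ψ (F z), two_mul]
  refine (integral_mono (integrable_re_trace_mul
    (hrev.isStationary.memLp_increment t (memLp_two_of_four hX₄))
    (hrev.isStationary.memLp_increment t (memLp_two_of_four hφF)))
    (((integrable_sum hF₄ τ).add (integrable_sum hX₄ τ⁻¹)).const_mul (1 / 4)) fun p =>
      mean_value_trace_inequality (hF p.2) (hF p.1) ((hX p.2).sub (hX p.1)) hφ hψ hτ).trans_eq ?_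
  rw [integral_const_mul, integral_add' (integrable_sum hF₄ τ) (integrable_sum hX₄ τ⁻¹),
    integral_const_mul, integral_const_mul, integral_sum hF₄, integral_sum hX₄]
  ring

end IsReversible

end DirichletForm

end MarkovSemigroup

theorem matExpect_isHermitian {Ω : Type*} [MeasurableSpace Ω] {d : ℕ} {ν : Measure Ω}
    {X : Ω → Matrix (Fin d) (Fin d) ℂ} (hX : ∀ z, (X z).IsHermitian) :
    (matExpect ν X).IsHermitian := by
  refine Matrix.IsHermitian.ext fun i j => ?_
  change (starRingEnd ℂ) (∫ y, X y j i ∂ν) = ∫ y, X y i j ∂ν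
  rw [← integral_conj]
  exact integral_congr_ae (Eventually.of_forall fun y => (hX y).apply i j)

namespace MarkovSemigroup.IsSuitable

open scoped Matrix.Norms.L2Operator MatrixOrder

variable {Ω : Type*} [MeasurableSpace Ω] {S : MarkovSemigroup Ω} {μ : Measure Ω}
  {𝒜 : Subalgebra ℝ (Ω → ℝ)} {d : ℕ} {X Y W : Ω → Matrix (Fin d) (Fin d) ℂ}

section CarreDuChamp

variable (h𝒜 : S.IsSuitable μ 𝒜)
include h𝒜

theorem integrable_sqIncrement (hX : X ∈ matAlgebra 𝒜 d) (t : NNReal) (z : Ω) :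
    Integrable (fun y => sqIncrement X (z, y)) (S.kernel t z) := by
  have increment_mem := Subalgebra.sub_mem _ hX (const_mem_coordinateAlgebra (X z))
  exact h𝒜.mat_integrable (Subalgebra.mul_mem _ increment_mem increment_mem) t z

theorem integral_sqIncrement (hX : X ∈ matAlgebra 𝒜 d) (t : NNReal) (z : Ω) :
    ∫ y, sqIncrement X (z, y) ∂S.kernel t z
      = S.matAct t (X * X) z - X z * S.matAct t X z - S.matAct t X z * X z + X z * X z := by
  have hXX := Subalgebra.mul_mem _ hX hX
  have integrable_X := h𝒜.mat_integrable hX t z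
  have integrable_sq : Integrable (fun y => X y * X y) (S.kernel t z) :=
    h𝒜.mat_integrable hXX t z
  have integrable_left : Integrable (fun y => X z * X y) (S.kernel t z) :=
    integrable_X.const_mul' (X z)
  have integrable_right : Integrable (fun y => X y * X z) (S.kernel t z) :=
    integrable_X.mul_const' (X z)
  have expand : ∀ y, sqIncrement X (z, y)
      = X y * X y - X z * X y - X y * X z + X z * X z := fun y => by
    rw [sqIncrement]
    noncomm_ring
  simp only [expand]
  refine (integral_add ((integrable_sq.sub integrable_left).sub integrable_right)
    (integrable_const _)).trans ?_
  rw [integral_sub' (integrable_sq.sub integrable_left) integrable_right,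
    integral_sub' integrable_sq integrable_left, integral_const, probReal_univ, one_smul,
    integral_const_mul_of_integrable integrable_X, integral_mul_const_of_integrable integrable_X,
    h𝒜.matAct_eq_integral hXX, h𝒜.matAct_eq_integral hX]
  rfl

theorem tendsto_Gamma (hX : X ∈ matAlgebra 𝒜 d) (z : Ω) :
    Tendsto (fun t : NNReal => (1 / 2 : ℝ) • ((t : ℝ)⁻¹ •
      ∫ y, sqIncrement X (z, y) ∂S.kernel t z)) (𝓝[>] 0) (𝓝 (S.Gamma X X z)) := by
  have tendsto_X := h𝒜.tendsto_matGenerator hX z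
  refine ((((h𝒜.tendsto_matGenerator (Subalgebra.mul_mem _ hX hX) z).sub
    (tendsto_X.const_mul (X z))).sub (tendsto_X.mul_const (X z))).const_smul
      (1 / 2 : ℝ)).congr fun t => ?_
  rw [h𝒜.integral_sqIncrement hX]
  simp only [Pi.mul_apply, mul_sub, sub_mul, smul_sub, smul_add, mul_smul_comm, smul_mul_assoc]
  abel

theorem Gamma_sub_const (hX : X ∈ matAlgebra 𝒜 d) (M : Matrix (Fin d) (Fin d) ℂ) :
    S.Gamma (fun z => X z - M) (fun z => X z - M) = S.Gamma X X := by
  funext z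
  refine tendsto_nhds_unique (h𝒜.tendsto_Gamma
    (Subalgebra.sub_mem _ hX (const_mem_coordinateAlgebra M)) z)
    ((h𝒜.tendsto_Gamma hX z).congr fun t => ?_)
  simp only [sqIncrement, Pi.sub_apply, sub_sub_sub_cancel_right]

theorem Gamma_posSemidef (hX : IsSuitableMat 𝒜 X) (z : Ω) : (S.Gamma X X z).PosSemidef := by
  rw [← Matrix.nonneg_iff_posSemidef]
  refine ge_of_tendsto' (h𝒜.tendsto_Gamma (isSuitableMat_iff.1 hX).2 z) fun t => ?_
  refine smul_nonneg (by norm_num) (smul_nonneg (by positivity) (integral_nonneg fun y => ?_))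
  have increment_isHermitian := (hX.isHermitian y).sub (hX.isHermitian z)
  have h := Matrix.posSemidef_conjTranspose_mul_self (X y - X z)
  rw [increment_isHermitian.eq] at h
  exact h.nonneg

theorem matAct_isSuitableMat (hX : IsSuitableMat 𝒜 X) (t : NNReal) :
    IsSuitableMat 𝒜 (S.matAct t X) :=
  isSuitableMat_iff.2 ⟨fun _ => matExpect_isHermitian hX.isHermitian,
    h𝒜.matAct_mem (isSuitableMat_iff.1 hX).2 t⟩

end CarreDuChamp

section DirichletForm

variable [IsFiniteMeasure μ]

theorem integral_sqIncrement_mul_fst (h𝒜 : S.IsSuitable μ 𝒜) (hstat : S.IsStationary μ)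
    (hW : MemLp W 4 μ) (t : ℝ) (Z : matAlgebra 𝒜 d) :
    ∫ p, (sqIncrement Z.1 p * W p.1).trace.re ∂S.jointLaw μ t.toNNReal
      = h𝒜.pairing hW (h𝒜.semigroupMap d t (Z * Z) - Z * h𝒜.semigroupMap d t Z
        - h𝒜.semigroupMap d t Z * Z + Z * Z) := by
  have hZ := h𝒜.mat_memLp Z.2 (p := 4) (by simp)
  rw [Measure.integral_compProd (hstat.integrable_sqIncrement_mul_fst _ hZ hW), pairing_apply]
  refine integral_congr_ae (Eventually.of_forall fun z => ?_)
  simp only [re_trace_mul_comm _ (W z)]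
  rw [integral_re_trace_mul _ (h𝒜.integrable_sqIncrement Z.2 _ z), h𝒜.integral_sqIncrement Z.2]
  rfl

theorem integral_increment_mul_increment_eq_pairing (h𝒜 : S.IsSuitable μ 𝒜)
    (hrev : S.IsReversible μ) (hW : MemLp W 4 μ) (t : ℝ) (Z : matAlgebra 𝒜 d) :
    ∫ p, ((Z.1 p.2 - Z.1 p.1) * (W p.2 - W p.1)).trace.re ∂S.jointLaw μ t.toNNReal
      = -(2 * h𝒜.pairing hW (h𝒜.semigroupMap d t Z - Z)) := by
  rw [hrev.integral_increment_mul_increment _ (h𝒜.mat_memLp Z.2 (by simp))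
    (memLp_two_of_four hW), map_sub, h𝒜.pairing_semigroupMap hrev.isStationary, pairing_apply]
  ring

theorem neg_pairing_generatorMap_le (h𝒜 : S.IsSuitable μ 𝒜) (hrev : S.IsReversible μ)
    {F G : matAlgebra 𝒜 d} (hF : ∀ z, (F.1 z).IsHermitian) (hG : ∀ z, (G.1 z).IsHermitian)
    {φ ψ : ℝ → ℝ} (hφ : ∀ a b, |φ a - φ b| ≤ |a - b| * ((ψ a + ψ b) / 2)) (hψ : ∀ a, 0 ≤ ψ a)
    (hφF : MemLp (fun z => cfc φ (F.1 z)) 4 μ) (hψF : MemLp (fun z => cfc ψ (F.1 z)) 4 μ)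
    {τ : ℝ} (hτ : 0 < τ) :
    -h𝒜.pairing hφF (h𝒜.generatorMap d G)
      ≤ 1 / 2 * (τ * h𝒜.pairing hψF (carreDuChamp (h𝒜.generatorMap d) F F)
        + τ⁻¹ * h𝒜.pairing hψF (carreDuChamp (h𝒜.generatorMap d) G G)) := by
  have H := h𝒜.isContractionSemigroup hrev.isStationary d
  have bounded_φ := h𝒜.isProductBounded_pairing hrev.isStationary hφF
  have bounded_ψ := h𝒜.isProductBounded_pairing hrev.isStationary hψF
  have tendsto_slope := ((bounded_φ.tendsto_of_null H (H.tendsto_generator G)).add_const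
    (h𝒜.pairing hφF (h𝒜.generatorMap d G))).neg
  rw [zero_add] at tendsto_slope
  refine le_of_tendsto_of_tendsto tendsto_slope
    ((((bounded_ψ.tendsto_carreDuChamp H F F).const_mul τ).add
      ((bounded_ψ.tendsto_carreDuChamp H G G).const_mul τ⁻¹)).const_mul (1 / 2)) ?_
  filter_upwards [self_mem_nhdsWithin] with h (hh : 0 < h)
  have bound := hrev.integral_increment_mul_cfc_increment_le h.toNNReal hF hG hφ hψ
    (h𝒜.mat_memLp F.2 (by simp)) (h𝒜.mat_memLp G.2 (by simp)) hφF hψF hτ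
  rw [h𝒜.integral_increment_mul_increment_eq_pairing hrev hφF,
    h𝒜.integral_sqIncrement_mul_fst hrev.isStationary hψF,
    h𝒜.integral_sqIncrement_mul_fst hrev.isStationary hψF] at bound
  rw [map_sub, sub_add_cancel, map_smul, smul_eq_mul, mul_inv]
  have scaled := mul_le_mul_of_nonneg_left bound (inv_pos.2 hh).le
  linarith

end DirichletForm

end MarkovSemigroup.IsSuitable

theorem re_trace_cfc_nonneg {n : Type*} [Fintype n] [DecidableEq n] {A : Matrix n n ℂ}
    (hA : A.IsHermitian) {u : ℝ → ℝ} (hu : ∀ i, 0 ≤ u (hA.eigenvalues i)) :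
    0 ≤ (cfc u A).trace.re :=
  (Finset.sum_nonneg fun i _ => hu i).trans_eq (re_trace_cfc hA u).symm

theorem sqrt_eq_rpow_rpow {a q : ℝ} (ha : 0 ≤ a) (hq : q ≠ 0) :
    (a ^ q) ^ (1 / (2 * q)) = √a := by
  rw [← Real.rpow_mul ha, Real.sqrt_eq_rpow]
  congr 1
  field_simp

section Integrability

open scoped Matrix.Norms.L2Operator

theorem re_trace_cfc_rpow_le {n : Type*} [Fintype n] [DecidableEq n] {A : Matrix n n ℂ}
    (hA : A.PosSemidef) {q v : ℝ} (hq : 0 ≤ q) (hv : ‖A‖ ≤ v) :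
    (cfc (fun x : ℝ => x ^ q) A).trace.re ≤ Fintype.card n * v ^ q := by
  rw [re_trace_cfc hA.isHermitian]
  refine (Finset.sum_le_card_nsmul _ _ (v ^ q) fun i _ => ?_).trans_eq (nsmul_eq_mul _ _)
  refine Real.rpow_le_rpow (hA.eigenvalues_nonneg i) (le_trans ?_ hv) hq
  exact (le_abs_self _).trans
    (abs_le_norm_of_mem_spectrum hA.isHermitian (hA.isHermitian.eigenvalues_mem_spectrum_real i))

theorem memLp_of_norm_le_rpow {Ω E F : Type*} [MeasurableSpace Ω] {μ : Measure Ω}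
    [IsFiniteMeasure μ] [NormedAddCommGroup E] [NormedAddCommGroup F] {X : Ω → E} {Y : Ω → F}
    (hX : ∀ p : ENNReal, p ≠ ⊤ → MemLp X p μ) (hY : AEStronglyMeasurable Y μ) {C r : ℝ}
    (hr : 0 ≤ r) (h : ∀ z, ‖Y z‖ ≤ C * ‖X z‖ ^ r) {p : ENNReal} (hp : p ≠ ⊤) : MemLp Y p μ := by
  rcases hr.eq_or_lt with rfl | hr
  · exact MemLp.of_bound hY C (Eventually.of_forall fun z => by simpa using h z)
  · have memLp_rpow := (hX (p * ENNReal.ofReal r)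
      (ENNReal.mul_ne_top hp ENNReal.ofReal_ne_top)).norm_rpow_div (ENNReal.ofReal r)
    rw [ENNReal.mul_div_cancel_right (by simpa using hr) ENNReal.ofReal_ne_top,
      ENNReal.toReal_ofReal hr.le] at memLp_rpow
    refine memLp_rpow.of_le_mul (c := C) hY (Eventually.of_forall fun z => ?_)
    rw [Real.norm_of_nonneg (by positivity)]
    exact h z

variable {Ω : Type*} [MeasurableSpace Ω] {S : MarkovSemigroup Ω} {μ : Measure Ω}
  [IsFiniteMeasure μ] {𝒜 : Subalgebra ℝ (Ω → ℝ)} {d : ℕ} {X : Ω → Matrix (Fin d) (Fin d) ℂ}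

namespace MarkovSemigroup.IsSuitable

theorem memLp_cfc (h𝒜 : S.IsSuitable μ 𝒜) (hX : IsSuitableMat 𝒜 X) {φ : ℝ → ℝ}
    (hφ : Continuous φ) {C r : ℝ} (hC : 0 ≤ C) (hr : 0 ≤ r) (h : ∀ x, |φ x| ≤ C * |x| ^ r)
    {p : ENNReal} (hp : p ≠ ⊤) : MemLp (fun z => cfc φ (X z)) p μ := by
  obtain ⟨isHermitian, mem⟩ := isSuitableMat_iff.1 hX
  exact memLp_of_norm_le_rpow (fun _ hp => h𝒜.mat_memLp mem hp)
    (stronglyMeasurable_cfc (h𝒜.mat_stronglyMeasurable mem) isHermitian hφ).aestronglyMeasurable hr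
    (fun z => norm_cfc_le_rpow (isHermitian z) hC hr h) hp

theorem memLp_cfc_oddPower (h𝒜 : S.IsSuitable μ 𝒜) (hX : IsSuitableMat 𝒜 X) {q : ℝ}
    (hq : 1 ≤ q) {p : ENNReal} (hp : p ≠ ⊤) : MemLp (fun z => cfc (oddPower q) (X z)) p μ :=
  h𝒜.memLp_cfc hX (continuous_oddPower hq) zero_le_one (by linarith : 0 ≤ 2 * q - 1)
    (fun x => by rw [abs_oddPower hq, one_mul]) hp

theorem memLp_cfc_oddPowerDeriv (h𝒜 : S.IsSuitable μ 𝒜) (hX : IsSuitableMat 𝒜 X) {q : ℝ}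
    (hq : 1 ≤ q) {p : ENNReal} (hp : p ≠ ⊤) :
    MemLp (fun z => cfc (oddPowerDeriv q) (X z)) p μ :=
  h𝒜.memLp_cfc hX (continuous_oddPowerDeriv hq) (by linarith : 0 ≤ 2 * q - 1)
    (by linarith : 0 ≤ 2 * q - 2) (fun x => (abs_of_nonneg (oddPowerDeriv_nonneg hq x)).le) hp

theorem integrable_re_trace_cfc (h𝒜 : S.IsSuitable μ 𝒜) (hX : IsSuitableMat 𝒜 X) {φ : ℝ → ℝ}
    (hφ : Continuous φ) {r : ℝ} (hr : 0 ≤ r) (h : ∀ x, |φ x| ≤ |x| ^ r) :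
    Integrable (fun z => (cfc φ (X z)).trace.re) μ :=
  (reTrace (Fin d)).integrable_comp (memLp_one_iff_integrable.1
    (h𝒜.memLp_cfc hX hφ zero_le_one hr (by simpa only [one_mul] using h) (by simp)))

theorem integrable_re_trace_abs_rpow (h𝒜 : S.IsSuitable μ 𝒜) (hX : IsSuitableMat 𝒜 X) {r : ℝ}
    (hr : 0 ≤ r) : Integrable (fun z => (cfc (fun x : ℝ => |x| ^ r) (X z)).trace.re) μ :=
  h𝒜.integrable_re_trace_cfc hX (continuous_abs_rpow hr) hr fun x =>
    (abs_of_nonneg (Real.rpow_nonneg (abs_nonneg x) r)).le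

omit [IsFiniteMeasure μ] in
theorem Gamma_isSuitableMat (h𝒜 : S.IsSuitable μ 𝒜) (hX : IsSuitableMat 𝒜 X) :
    IsSuitableMat 𝒜 (S.Gamma X X) :=
  isSuitableMat_iff.2 ⟨fun z => (h𝒜.Gamma_posSemidef hX z).isHermitian,
    (carreDuChamp (h𝒜.generatorMap d) ⟨X, (isSuitableMat_iff.1 hX).2⟩
      ⟨X, (isSuitableMat_iff.1 hX).2⟩).2⟩

theorem integrable_re_trace_Gamma_rpow (h𝒜 : S.IsSuitable μ 𝒜) (hX : IsSuitableMat 𝒜 X) {q : ℝ}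
    (hq : 0 ≤ q) : Integrable (fun z => (cfc (fun x : ℝ => x ^ q) (S.Gamma X X z)).trace.re) μ :=
  h𝒜.integrable_re_trace_cfc (h𝒜.Gamma_isSuitableMat hX) (Real.continuous_rpow_const hq) hq
    fun x => Real.abs_rpow_le_abs_rpow x q

end MarkovSemigroup.IsSuitable

end Integrability

namespace MarkovSemigroup.IsSuitable

open scoped Matrix.Norms.L2Operator

variable {Ω : Type*} [MeasurableSpace Ω] {S : MarkovSemigroup Ω} {μ : Measure Ω}
  [IsFiniteMeasure μ] {𝒜 : Subalgebra ℝ (Ω → ℝ)} {d : ℕ} {F : matAlgebra 𝒜 d} {c q : ℝ}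

theorem tendsto_eLpNorm_matAct (h𝒜 : S.IsSuitable μ 𝒜) (herg : S.IsErgodic μ)
    {X : Ω → Matrix (Fin d) (Fin d) ℂ} (hX : X ∈ matAlgebra 𝒜 d) :
    Tendsto (fun t : NNReal => eLpNorm (fun z => S.matAct t X z - ∫ y, X y ∂μ) 2 μ) atTop
      (𝓝 0) := by
  have integrable_X := memLp_one_iff_integrable.1 (h𝒜.mat_memLp hX (by simp))
  refine tendsto_eLpNorm_of_dual one_le_two (fun ℓ t => h𝒜.measurable _ (Subalgebra.sub_mem _
    (h𝒜.matAct_mem hX t) (const_mem_coordinateAlgebra (∫ y, X y ∂μ)) ℓ)) fun ℓ => ?_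
  have dual_integral : ℓ (∫ y, X y ∂μ) = ∫ y, ℓ (X y) ∂μ :=
    (ℓ.toContinuousLinearMap.integral_comp_comm integrable_X).symm
  simp only [map_sub, h𝒜.dual_matAct hX, dual_integral]
  exact herg _ (h𝒜.memLp _ (hX ℓ))

theorem tendsto_seminormL2_semigroupMap (h𝒜 : S.IsSuitable μ 𝒜) (herg : S.IsErgodic μ)
    (hF : ∫ z, F.1 z ∂μ = 0) :
    Tendsto (fun t => h𝒜.seminormL2 d (h𝒜.semigroupMap d t F)) atTop (𝓝 0) := by
  have h := h𝒜.tendsto_eLpNorm_matAct herg F.2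
  simp only [hF, sub_zero] at h
  simp only [seminormL2_apply]
  exact (ENNReal.tendsto_toReal ENNReal.zero_ne_top).comp (h.comp tendsto_real_toNNReal_atTop)

section Decay

variable (h𝒜 : S.IsSuitable μ 𝒜) (hF : IsSuitableMat 𝒜 F.1) (hc : 0 < c)
  (hBE : S.BakryEmery μ 𝒜 d c) {φ ψ : ℝ → ℝ} (hψ : ∀ a, 0 ≤ ψ a)
  (hψF : MemLp (fun z => cfc ψ (F.1 z)) 4 μ) {t b : ℝ}
include h𝒜 hF hc hBE hψ

theorem pairing_carreDuChamp_semigroupMap_le (hstat : S.IsStationary μ) (ht : 0 ≤ t) :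
    h𝒜.pairing hψF (carreDuChamp (h𝒜.generatorMap d) (h𝒜.semigroupMap d t F)
        (h𝒜.semigroupMap d t F))
      ≤ Real.exp (-(2 / c) * t)
        * h𝒜.pairing hψF (h𝒜.semigroupMap d t (carreDuChamp (h𝒜.generatorMap d) F F)) := by
  refine (h𝒜.isProductBounded_pairing hstat hψF).carreDuChamp_semigroup_le
    (h𝒜.isContractionSemigroup hstat d) F F hc ht fun s v _ _ => ?_
  rw [← sub_nonneg, ← smul_eq_mul, ← map_smul, ← map_smul, ← map_sub, ← map_sub]
  refine h𝒜.pairing_semigroupMap_nonneg hstat hψF (fun z A hA => ?_) s _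
    (hBE _ (h𝒜.matAct_isSuitableMat hF v.toNNReal))
  rw [re_trace_mul_comm]
  exact re_trace_mul_cfc_nonneg hA (hF.isHermitian z) hψ

variable (hrev : S.IsReversible μ) (hφ : ∀ a b, |φ a - φ b| ≤ |a - b| * ((ψ a + ψ b) / 2))
  (hφF : MemLp (fun z => cfc φ (F.1 z)) 4 μ)
  (hb : ∀ t, c * h𝒜.pairing hψF
    (h𝒜.semigroupMap d t (carreDuChamp (h𝒜.generatorMap d) F F)) ≤ b)
include hrev hφ hb

theorem neg_pairing_semigroupMap_generatorMap_le (ht : 0 ≤ t) :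
    -h𝒜.pairing hφF (h𝒜.semigroupMap d t (h𝒜.generatorMap d F))
      ≤ c⁻¹ * Real.exp (-c⁻¹ * t) * b := by
  have H := h𝒜.isContractionSemigroup hrev.isStationary d
  have le_b (r : ℝ) := (le_inv_mul_iff₀ hc).2 (hb r)
  have initial_le := le_b 0
  rw [H.zero] at initial_le
  have decay := (h𝒜.pairing_carreDuChamp_semigroupMap_le hF hc hBE hψ hψF hrev.isStationary
    ht).trans (mul_le_mul_of_nonneg_left (le_b t) (Real.exp_pos _).le)
  set τ := Real.exp (-c⁻¹ * t)
  have hτ : 0 < τ := Real.exp_pos _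
  have exp_eq : Real.exp (-(2 / c) * t) = τ * τ := by
    rw [← Real.exp_add]
    ring_nf
  rw [exp_eq] at decay
  rw [← (h𝒜.isProductBounded_pairing hrev.isStationary hφF).congr H (H.generator_comm ht F)]
  calc _ ≤ 1 / 2 * (τ * _ + τ⁻¹ * _) := h𝒜.neg_pairing_generatorMap_le hrev hF.isHermitian
        (h𝒜.matAct_isSuitableMat hF _).isHermitian hφ hψ hφF hψF hτ
    _ ≤ 1 / 2 * (τ * (c⁻¹ * b) + τ⁻¹ * (τ * τ * (c⁻¹ * b))) := by gcongr
    _ = c⁻¹ * τ * b := by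
      field_simp
      ring

theorem pairing_self_le (herg : S.IsErgodic μ) (hF₀ : ∫ z, F.1 z ∂μ = 0) :
    h𝒜.pairing hφF F ≤ b := by
  have H := h𝒜.isContractionSemigroup hrev.isStationary d
  have bounded := h𝒜.isProductBounded_pairing hrev.isStationary hφF
  have h := le_of_neg_deriv_right_le_exp (inv_pos.2 hc) (bounded.continuousOn_orbit H F)
    (fun t ht => bounded.hasDerivWithinAt_orbit H F ht)
    (fun t ht => h𝒜.neg_pairing_semigroupMap_generatorMap_le hF hc hBE hψ hψF hrev hφ hφF hb ht)
    (bounded.tendsto_of_null H (h𝒜.tendsto_seminormL2_semigroupMap herg hF₀))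
  rwa [H.zero] at h

end Decay

theorem mul_pairing_semigroupMap_carreDuChamp_le (h𝒜 : S.IsSuitable μ 𝒜)
    (hstat : S.IsStationary μ) (hc : 0 ≤ c) (hq : 1 ≤ q) (hF : IsSuitableMat 𝒜 F.1)
    (hψF : MemLp (fun z => cfc (oddPowerDeriv q) (F.1 z)) 4 μ) (t : ℝ) :
    c * h𝒜.pairing hψF (h𝒜.semigroupMap d t (carreDuChamp (h𝒜.generatorMap d) F F))
      ≤ (c * (2 * q - 1)) ^ q / q
          * ∫ z, (cfc (fun x : ℝ => x ^ q) (S.Gamma F.1 F.1 z)).trace.re ∂μ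
        + (1 - 1 / q) * ∫ z, (cfc (fun x : ℝ => |x| ^ (2 * q)) (F.1 z)).trace.re ∂μ := by
  have fst_preserving := measurePreserving_fst (S := S) (μ := μ) t.toNNReal
  have snd_preserving := hstat.measurePreserving_snd t.toNNReal
  have integrable_Γ := h𝒜.integrable_re_trace_Gamma_rpow hF (by linarith : 0 ≤ q)
  have integrable_F := h𝒜.integrable_re_trace_abs_rpow hF (by linarith : 0 ≤ 2 * q)
  have integrable_Γ_snd := snd_preserving.integrable_comp_of_integrable
    (integrable_Γ.const_mul ((c * (2 * q - 1)) ^ q / q))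
  have integrable_F_fst := fst_preserving.integrable_comp_of_integrable
    (integrable_F.const_mul (1 - 1 / q))
  rw [h𝒜.pairing_semigroupMap hstat, ← integral_const_mul, ← integral_const_mul,
    ← integral_const_mul,
    ← integral_comp_of_measurePreserving snd_preserving (integrable_Γ.1.const_mul _),
    ← integral_comp_of_measurePreserving fst_preserving (integrable_F.1.const_mul _),
    ← integral_add (by exact integrable_Γ_snd) (by exact integrable_F_fst)]
  refine integral_mono ((integrable_re_trace_mul ?_ ?_).const_mul _)
    (integrable_Γ_snd.add integrable_F_fst) fun p => ?_
  · exact (memLp_two_of_four hψF).comp_measurePreserving fst_preserving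
  · exact (h𝒜.mat_memLp (carreDuChamp (h𝒜.generatorMap d) F F).2
      (by simp)).comp_measurePreserving snd_preserving
  · simp only [re_trace_mul_comm _ ((carreDuChamp (h𝒜.generatorMap d) F F).1 p.2)]
    exact re_trace_mul_cfc_oddPowerDeriv_le (h𝒜.Gamma_posSemidef hF p.2) (hF.isHermitian p.1) hc hq

theorem integral_re_trace_abs_rpow_le (h𝒜 : S.IsSuitable μ 𝒜) (hrev : S.IsReversible μ)
    (herg : S.IsErgodic μ) (hc : 0 < c) (hBE : S.BakryEmery μ 𝒜 d c) (hq : q = 1 ∨ 3 / 2 ≤ q)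
    {f : Ω → Matrix (Fin d) (Fin d) ℂ} (hf : IsSuitableMat 𝒜 f) (hf₀ : ∫ z, f z ∂μ = 0) :
    ∫ z, (cfc (fun x : ℝ => |x| ^ (2 * q)) (f z)).trace.re ∂μ
      ≤ (c * (2 * q - 1)) ^ q
        * ∫ z, (cfc (fun x : ℝ => x ^ q) (S.Gamma f f z)).trace.re ∂μ := by
  have one_le_q : 1 ≤ q := by rcases hq with h | h <;> linarith
  let F : matAlgebra 𝒜 d := ⟨f, (isSuitableMat_iff.1 hf).2⟩
  have hφF := h𝒜.memLp_cfc_oddPower hf one_le_q (p := 4) (by simp)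
  have hψF := h𝒜.memLp_cfc_oddPowerDeriv hf one_le_q (p := 4) (by simp)
  have pairing_eq : h𝒜.pairing hφF F
      = ∫ z, (cfc (fun x : ℝ => |x| ^ (2 * q)) (f z)).trace.re ∂μ :=
    integral_congr_ae (Eventually.of_forall fun z => (re_trace_mul_comm _ _).trans
      (congrArg (fun A => A.trace.re) (mul_cfc_oddPower (hf.isHermitian z) one_le_q)))
  have pairing_le : ∫ z, (cfc (fun x : ℝ => |x| ^ (2 * q)) (f z)).trace.re ∂μ
      ≤ (c * (2 * q - 1)) ^ q / q
          * ∫ z, (cfc (fun x : ℝ => x ^ q) (S.Gamma f f z)).trace.re ∂μ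
        + (1 - 1 / q) * ∫ z, (cfc (fun x : ℝ => |x| ^ (2 * q)) (f z)).trace.re ∂μ :=
    pairing_eq.ge.trans (h𝒜.pairing_self_le (F := F) hf hc hBE (oddPowerDeriv_nonneg one_le_q) hψF
      hrev (abs_oddPower_sub_le hq) hφF (h𝒜.mul_pairing_semigroupMap_carreDuChamp_le
        hrev.isStationary hc.le one_le_q hf hψF) herg hf₀)
  refine (div_le_div_iff_of_pos_right (zero_lt_one.trans_le one_le_q)).1 ?_
  rw [mul_div_right_comm]
  exact (le_of_eq (by ring)).trans (sub_le_iff_le_add.2 pairing_le)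

end MarkovSemigroup.IsSuitable

namespace MarkovSemigroup.IsSuitable

open scoped Matrix.Norms.L2Operator

variable {Ω : Type*} [MeasurableSpace Ω] {S : MarkovSemigroup Ω} {μ : Measure Ω}
  [IsProbabilityMeasure μ] {𝒜 : Subalgebra ℝ (Ω → ℝ)} {d : ℕ} {f : Ω → Matrix (Fin d) (Fin d) ℂ}

theorem integral_sub_matExpect (h𝒜 : S.IsSuitable μ 𝒜) (hf : f ∈ matAlgebra 𝒜 d) :
    ∫ z, (f z - matExpect μ f) ∂μ = 0 := by
  have integrable_f := memLp_one_iff_integrable.1 (h𝒜.mat_memLp hf (by simp))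
  rw [integral_sub integrable_f (integrable_const _), integral_const, probReal_univ, one_smul,
    matExpect_eq_integral integrable_f, sub_self]

theorem integral_re_trace_Gamma_rpow_le (h𝒜 : S.IsSuitable μ 𝒜) (hf : IsSuitableMat 𝒜 f)
    {q : ℝ} (hq : 0 ≤ q) (hv : S.varianceProxy μ f < ⊤) :
    ∫ z, (cfc (fun x : ℝ => x ^ q) (S.Gamma f f z)).trace.re ∂μ
      ≤ d * (S.varianceProxy μ f).toReal ^ q := by
  have norm_le : ∀ᵐ z ∂μ, ‖S.Gamma f f z‖ ≤ (S.varianceProxy μ f).toReal := by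
    filter_upwards [ae_le_eLpNormEssSup (f := fun z => specNorm (S.Gamma f f z)) (μ := μ)]
      with z hz
    rw [← eLpNorm_exponent_top] at hz
    have h := ENNReal.toReal_mono hv.ne hz
    exact (le_abs_self _).trans (by rwa [toReal_enorm] at h)
  have h := integral_mono_ae (h𝒜.integrable_re_trace_Gamma_rpow hf hq)
    (integrable_const (d * (S.varianceProxy μ f).toReal ^ q)) (norm_le.mono fun z hz => by
      simpa only [Fintype.card_fin] using re_trace_cfc_rpow_le (h𝒜.Gamma_posSemidef hf z) hq hz)
  rwa [integral_const, probReal_univ, one_smul] at h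

end MarkovSemigroup.IsSuitable

theorem IsSuitableMat.sub_const {Ω : Type*} {𝒜 : Subalgebra ℝ (Ω → ℝ)} {d : ℕ}
    {f : Ω → Matrix (Fin d) (Fin d) ℂ} (hf : IsSuitableMat 𝒜 f) {M : Matrix (Fin d) (Fin d) ℂ}
    (hM : M.IsHermitian) : IsSuitableMat 𝒜 fun z => f z - M :=
  isSuitableMat_iff.2 ⟨fun z => (hf.isHermitian z).sub hM,
    Subalgebra.sub_mem _ (isSuitableMat_iff.1 hf).2 (const_mem_coordinateAlgebra M)⟩

theorem theorem3p1_general {Ω : Type*} [MeasurableSpace Ω] (μ : Measure Ω)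
    [IsProbabilityMeasure μ] (S : MarkovSemigroup Ω) (hrev : S.IsReversible μ)
    (herg : S.IsErgodic μ) (𝒜 : Subalgebra ℝ (Ω → ℝ)) (h𝒜 : S.IsSuitable μ 𝒜)
    (d : ℕ) (c : ℝ) (hc : 0 < c) (hBE : S.BakryEmery μ 𝒜 d c)
    (f : Ω → Matrix (Fin d) (Fin d) ℂ) (hf : IsSuitableMat 𝒜 f)
    (q : ℝ) (hq : q = 1 ∨ 3 / 2 ≤ q) :
    Integrable
      (fun z => (cfc (fun x : ℝ => |x| ^ (2 * q)) (f z - matExpect μ f)).trace.re) μ ∧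
    Integrable (fun z => (cfc (fun x : ℝ => x ^ q) (S.Gamma f f z)).trace.re) μ ∧
    (∫ z, (cfc (fun x : ℝ => |x| ^ (2 * q)) (f z - matExpect μ f)).trace.re ∂μ) ^ (1 / (2 * q))
      ≤ Real.sqrt (c * (2 * q - 1)) *
        (∫ z, (cfc (fun x : ℝ => x ^ q) (S.Gamma f f z)).trace.re ∂μ) ^ (1 / (2 * q)) ∧
    (S.varianceProxy μ f < ⊤ →
      (∫ z, (cfc (fun x : ℝ => |x| ^ (2 * q)) (f z - matExpect μ f)).trace.re ∂μ)
          ^ (1 / (2 * q))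
        ≤ (d : ℝ) ^ (1 / (2 * q)) *
          Real.sqrt (c * (2 * q - 1) * (S.varianceProxy μ f).toReal)) := by
  have q_pos : 0 < q := by rcases hq with h | h <;> linarith
  have hk : 0 ≤ c * (2 * q - 1) := mul_nonneg hc.le (by rcases hq with h | h <;> linarith)
  have hg := hf.sub_const (matExpect_isHermitian (ν := μ) hf.isHermitian)
  have moment_le := h𝒜.integral_re_trace_abs_rpow_le hrev herg hc hBE hq hg
    (h𝒜.integral_sub_matExpect (isSuitableMat_iff.1 hf).2)
  rw [h𝒜.Gamma_sub_const (isSuitableMat_iff.1 hf).2] at moment_le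
  have moment_nonneg : 0 ≤ ∫ z, (cfc (fun x : ℝ => |x| ^ (2 * q))
      (f z - matExpect μ f)).trace.re ∂μ :=
    integral_nonneg fun z => re_trace_cfc_nonneg (hg.isHermitian z) fun _ => by positivity
  have Γ_nonneg : 0 ≤ ∫ z, (cfc (fun x : ℝ => x ^ q) (S.Gamma f f z)).trace.re ∂μ :=
    integral_nonneg fun z => re_trace_cfc_nonneg (h𝒜.Gamma_posSemidef hf z).isHermitian fun i =>
      Real.rpow_nonneg ((h𝒜.Gamma_posSemidef hf z).eigenvalues_nonneg i) q
  refine ⟨h𝒜.integrable_re_trace_abs_rpow hg (by positivity),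
    h𝒜.integrable_re_trace_Gamma_rpow hf q_pos.le, ?_, fun hv => ?_⟩
  · refine (Real.rpow_le_rpow moment_nonneg moment_le (by positivity)).trans_eq ?_
    rw [Real.mul_rpow (by positivity) Γ_nonneg, sqrt_eq_rpow_rpow hk q_pos.ne']
  · have bound := moment_le.trans (mul_le_mul_of_nonneg_left
      (h𝒜.integral_re_trace_Gamma_rpow_le hf q_pos.le hv) (by positivity))
    rw [mul_left_comm, ← Real.mul_rpow hk ENNReal.toReal_nonneg] at bound
    refine (Real.rpow_le_rpow moment_nonneg bound (by positivity)).trans_eq ?_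
    rw [Real.mul_rpow (by positivity) (by positivity), sqrt_eq_rpow_rpow (by positivity) q_pos.ne']

theorem theorem3p1 {Ω : Type*} [TopologicalSpace Ω] [PolishSpace Ω] [MeasurableSpace Ω]
    [BorelSpace Ω] (μ : Measure Ω) [IsProbabilityMeasure μ]
    (S : MarkovSemigroup Ω) (hstat : S.IsStationary μ) (hrev : S.IsReversible μ)
    (herg : S.IsErgodic μ)
    (𝒜 : Subalgebra ℝ (Ω → ℝ)) (h𝒜 : S.IsSuitable μ 𝒜)
    (d : ℕ) (c : ℝ) (hc : 0 < c) (hBE : S.BakryEmery μ 𝒜 d c)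
    (f : Ω → Matrix (Fin d) (Fin d) ℂ) (hf : IsSuitableMat 𝒜 f)
    (q : ℝ) (hq : q = 1 ∨ 3 / 2 ≤ q) :
    Integrable
      (fun z => (cfc (fun x : ℝ => |x| ^ (2 * q)) (f z - matExpect μ f)).trace.re) μ ∧
    Integrable (fun z => (cfc (fun x : ℝ => x ^ q) (S.Gamma f f z)).trace.re) μ ∧
    (∫ z, (cfc (fun x : ℝ => |x| ^ (2 * q)) (f z - matExpect μ f)).trace.re ∂μ) ^ (1 / (2 * q))
      ≤ Real.sqrt (c * (2 * q - 1)) *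
        (∫ z, (cfc (fun x : ℝ => x ^ q) (S.Gamma f f z)).trace.re ∂μ) ^ (1 / (2 * q)) ∧
    (S.varianceProxy μ f < ⊤ →
      (∫ z, (cfc (fun x : ℝ => |x| ^ (2 * q)) (f z - matExpect μ f)).trace.re ∂μ)
          ^ (1 / (2 * q))
        ≤ (d : ℝ) ^ (1 / (2 * q)) *
          Real.sqrt (c * (2 * q - 1) * (S.varianceProxy μ f).toReal)) :=
  theorem3p1_general μ S hrev herg 𝒜 h𝒜 d c hc hBE f hf q hq
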